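/- Let $(X,\mathcal B,\mu,T)$ be an invertible measure-preserving system on a non-atomic standard Borel probability space, and let $A=(t_n)_{n\ge 1}$ be a strictly increasing sequence of non-negative integers. For a finite measurable partition $\xi=\{X_1,\dots,X_m\}$ put $H(\xi)=-\sum_i\mu(X_i)\log\mu(X_i)$ (with $0\log 0=0$), and define the sequence entropy of $T$ along $A$ by \[h^A(T)=\sup_{\xi}\,h^A(T,\xi),\qquad h^A(T,\xi)=\limsup_{n\to\infty}\frac1n H\Big(\bigvee_{k=1}^n T^{-t_k}\xi\Big),\] the supremum being over all finite measurable partitions $\xi$ of $X$. The system is called a rank one system if there are integers $q_n\ge 2$ $(n\ge 0)$ and $a_{n,i}\ge 0$ $(n\ge0,\ 1\le i\le q_n-1)$ such that, with $a_n=\sum_{i=1}^{q_n-1}a_{n,i}$, $h_0=1$ and $h_{n+1}=q_nh_n+a_n$, the series $\sum_n a_n/h_{n+1}$ converges, and measurable sets $F_n$, $F_{n,i}$ $(1\le i\le q_n)$ and $C_{n,i,j}$ $(1\le i\le q_n-1,\ 1\le j\le a_{n,i})$ such that for every $n\ge 0$: (a) $F_n,TF_n,\dots,T^{h_n-1}F_n$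 are pairwise disjoint; (b) $F_n$ is the disjoint union of $F_{n,1},\dots,F_{n,q_n}$; (c) for $1\le i\le q_n-1$, $T^{h_n}F_{n,i}$ equals $C_{n,i,1}$ if $a_{n,i}>0$ and $F_{n,i+1}$ if $a_{n,i}=0$; (d) for $1\le i\le q_n-1$, $TC_{n,i,j}=C_{n,i,j+1}$ for $1\le j<a_{n,i}$, and $TC_{n,i,a_{n,i}}=F_{n,i+1}$ if $a_{n,i}>0$; (e) $F_{n+1}=F_{n,1}$; and such that the partitions $\xi_n=\{F_n,TF_n,\dots,T^{h_n-1}F_n,\ X\setminus\bigcup_{k<h_n}T^kF_n\}$ approach the point partition, i.e. for every $B\in\mathcal B$ and $\varepsilon>0$, for all sufficiently large $n$ there is a union $U$ of atoms of $\xi_n$ with $\mu(B\triangle U)<\varepsilon$. **Theorem.** Let $\beta>0$ and let $A=(t_n)_{n\ge1}$ with $t_n=\lfloor n^\alpha\rfloor$, where $\alpha=1+1/\beta$. (i) For every real $m>0$ there is a rank one system $(X,\mathcal B,\mu,T)$ with $0<h^A(T)<m$. (ii) For every integer $L\ge 2$ there is a rank one system $(X,\mathcal B,\mu,T)$ with \[C_1\log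 L\le h^A(T)\le C_2\log L,\qquad C_1=\frac{\beta}{1+\beta},\quad C_2=(2\beta)^{\frac1{1+\beta}}.\] -/

import Mathlib

open MeasureTheory Filter

noncomputable section

namespace SeqEnt

/-! ### Sequence entropy -/

/-- Shannon entropy `∑ i, f (μ (X_i))`, `f x = -x log x`, of the finite partition
`X_i = φ ⁻¹' {i}` given by its coding function `φ : X → ι`. -/
def shannonEntropy {X : Type*} [MeasurableSpace X] (μ : Measure X) {ι : Type*} [Fintype ι]
    (φ : X → ι) : ℝ :=
  ∑ i : ι, Real.negMulLog (μ.real (φ ⁻¹' {i}))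

/-- The sequence coding map `x ↦ φ (T^{t_1} x) ⋯ φ (T^{t_n} x)`; it is the coding function of the
join `⋁_{k=1}^n T^{-t_k} ξ` when `φ` is that of `ξ`. -/
def seqCoding {X : Type*} (T : X → X) (t : ℕ → ℕ) {ι : Type*} (φ : X → ι) (n : ℕ) (x : X) :
    Fin n → ι :=
  fun k => φ (T^[t (k + 1)] x)

/-- `h^A(T, ξ) = limsup_n (1/n) H(⋁_{k=1}^n T^{-t_k} ξ)`, where `A = (t_n)_{n ≥ 1}` and `ξ` is the
finite partition with coding function `φ`. -/
def seqEntropyOf {X : Type*} [MeasurableSpace X] (μ : Measure X) (T : X → X) (t : ℕ → ℕ)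
    {ι : Type*} [Fintype ι] (φ : X → ι) : EReal :=
  limsup (fun n : ℕ => ((1 / (n : ℝ) * shannonEntropy μ (seqCoding T t φ n) : ℝ) : EReal)) atTop

/-- `h^A(T)`, the supremum of `h^A(T, ξ)` over all finite measurable partitions `ξ` of `X`. -/
def seqEntropy {X : Type*} [MeasurableSpace X] (μ : Measure X) (T : X → X) (t : ℕ → ℕ) : EReal :=
  ⨆ (m : ℕ) (φ : X → Fin m) (_ : Measurable φ), seqEntropyOf μ T t φ

/-! ### Rank one systems (constructive geometric definition) -/

/-- `a_n = ∑_{i=1}^{q_n - 1} a_{n,i}`. -/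
def spacerCount (q : ℕ → ℕ) (a : ℕ → ℕ → ℕ) (n : ℕ) : ℕ :=
  ∑ i ∈ Finset.Ico 1 (q n), a n i

/-- The tower heights `h_0 = 1`, `h_{n+1} = q_n h_n + a_n`. -/
def height (q : ℕ → ℕ) (a : ℕ → ℕ → ℕ) : ℕ → ℕ
  | 0 => 1
  | n + 1 => q n * height q a n + spacerCount q a n

/-- The partition `{F, TF, …, T^{h-1}F, X ∖ ⋃_{k<h} T^k F}` induced by a tower. -/
def towerPartition {X : Type*} (T : X → X) (F : Set X) (h : ℕ) : Set (Set X) :=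
  {A | ∃ k < h, A = T^[k] '' F} ∪ {(⋃ k < h, T^[k] '' F)ᶜ}

/-- The partitions `ξ n` approach the point partition: every measurable set is approximated in
measure by unions of atoms of `ξ n`, for all large `n`. -/
def ApproachesPoints {X : Type*} [MeasurableSpace X] (μ : Measure X) (ξ : ℕ → Set (Set X)) :
    Prop :=
  ∀ B : Set X, MeasurableSet B → ∀ ε : ENNReal, 0 < ε →
    ∃ N : ℕ, ∀ n ≥ N, ∃ J ⊆ ξ n, μ (symmDiff B (⋃₀ J)) < ε

/-- `T` is obtained by cutting and stacking: at step `n` the tower with base `F n` and height `h_n`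
is cut into the `q n` columns over `Fs n i` (`1 ≤ i ≤ q n`), and `a n i` spacer levels
`C n i j` (`1 ≤ j ≤ a n i`) are put on top of the `i`-th column for `1 ≤ i < q n`. -/
structure IsCutAndStack {X : Type*} [MeasurableSpace X] (μ : Measure X) (T : X → X)
    (q : ℕ → ℕ) (a : ℕ → ℕ → ℕ) (F : ℕ → Set X) (Fs : ℕ → ℕ → Set X)
    (C : ℕ → ℕ → ℕ → Set X) : Prop where
  two_le_q : ∀ n, 2 ≤ q n
  summable_spacers :
    Summable fun n => (spacerCount q a n : ℝ) / (height q a (n + 1) : ℝ)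
  measurable_F : ∀ n, MeasurableSet (F n)
  measurable_Fs : ∀ n i, 1 ≤ i → i ≤ q n → MeasurableSet (Fs n i)
  measurable_C : ∀ n i j, 1 ≤ i → i < q n → 1 ≤ j → j ≤ a n i → MeasurableSet (C n i j)
  levels_disjoint : ∀ n k l, k < height q a n → l < height q a n → k ≠ l →
    Disjoint (T^[k] '' F n) (T^[l] '' F n)
  columns_disjoint : ∀ n i j, 1 ≤ i → i ≤ q n → 1 ≤ j → j ≤ q n → i ≠ j →
    Disjoint (Fs n i) (Fs n j)
  columns_cover : ∀ n, F n = ⋃ i ∈ Finset.Icc 1 (q n), Fs n i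
  top_to_spacer : ∀ n i, 1 ≤ i → i < q n → 0 < a n i →
    T^[height q a n] '' Fs n i = C n i 1
  top_to_next : ∀ n i, 1 ≤ i → i < q n → a n i = 0 →
    T^[height q a n] '' Fs n i = Fs n (i + 1)
  spacer_to_spacer : ∀ n i j, 1 ≤ i → i < q n → 1 ≤ j → j < a n i →
    T '' C n i j = C n i (j + 1)
  spacer_to_next : ∀ n i, 1 ≤ i → i < q n → 0 < a n i →
    T '' C n i (a n i) = Fs n (i + 1)
  next_base : ∀ n, F (n + 1) = Fs n 1
  generating : ApproachesPoints μ fun n => towerPartition T (F n) (height q a n)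

/-- `(X, μ, T)` is a rank one system: `μ` is a non-atomic (points are null) probability measure on a standard Borel
space, the invertible map `T` preserves `μ`, and `T` is obtained by cutting and stacking. -/
structure IsRankOneSystem {X : Type*} [MeasurableSpace X] (μ : Measure X) (T : X ≃ᵐ X) :
    Prop where
  standardBorel : StandardBorelSpace X
  isProbabilityMeasure : IsProbabilityMeasure μ
  nullSingleton : NullSingletonClass μ
  measurePreserving : MeasurePreserving T μ μ
  cutAndStack : ∃ q a F Fs C, IsCutAndStack μ T q a F Fs C

end SeqEnt

end

/-!
The systems are built over the dyadic odometer by inserting spacers, at step `n` fewer than `L`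
above each column of the tower of height `h_n`, in the order in which the digits appear when all
words of length `κ_n ≈ C (C h_n) ^ β` over `L` letters are written one after the other. Orbits run
through the towers, and an orbit over a time much longer than `h_n` is determined by its initial
level and by the sequence of spacer numbers between its visits to the tower `n`.

Upper bound: every partition is approximated by levels of a tower, and the names of the first `N`
times have entropy at most `log h_n + (N ^ (1 + 1 / β) / h_n) log L` for each tower `n`. For `n`
minimal with `N ≤ (C h_n) ^ β` this is at most `N (C log L + o(1))`, since
`log h_n ≈ C (C h_{n - 1}) ^ β log L` and `(C h_{n - 1}) ^ β < N`.

Lower bound: for `N` slightly below `(C h_n) ^ β` and `C ≤ β / (1 + β)` the steps between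
consecutive times are shorter than `h_n`, so no visit to the tower is skipped and the spacer numbers
can be read off the levels seen at these times. About `C N` of them are seen, which is not more than
`κ_n`, and they are almost uniformly distributed, because the windows of the concatenation of all
words are almost equidistributed. Only when a time falls near the edge of a tower is the spacer
number not visible; recording it separately costs a small proportion of `N`. Hence the entropy is
`C log L` exactly.
-/

noncomputable section

namespace SeqEnt

section Entropy

variable {X : Type*} [MeasurableSpace X] {μ : Measure X} {ι κ : Type*}

theorem sum_negMulLog_le_sum_mul_neg_log [Fintype ι] {p q : ι → ℝ} (hp : ∀ i, 0 ≤ p i)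
    (hq : ∀ i, 0 ≤ q i) (hpq : ∀ i, q i = 0 → p i = 0) (hsum : ∑ i, q i ≤ ∑ i, p i) :
    ∑ i, Real.negMulLog (p i) ≤ ∑ i, p i * -Real.log (q i) := by
  have hterm : ∀ i, Real.negMulLog (p i) ≤ p i * -Real.log (q i) + (q i - p i) := by
    intro i
    rcases (hp i).eq_or_lt with hpi | hpi
    · simpa [← hpi] using hq i
    · have hqi : 0 < q i := (hq i).lt_of_ne' fun h => hpi.ne' (hpq i h)
      have hlog := Real.log_le_sub_one_of_pos (div_pos hqi hpi)
      rw [Real.log_div hqi.ne' hpi.ne'] at hlog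
      have hmul := mul_le_mul_of_nonneg_left hlog hpi.le
      have hcancel : p i * (q i / p i - 1) = q i - p i := by field_simp
      rw [Real.negMulLog]
      linarith
  calc ∑ i, Real.negMulLog (p i) ≤ ∑ i, (p i * -Real.log (q i) + (q i - p i)) :=
        Finset.sum_le_sum fun i _ => hterm i
    _ = ∑ i, p i * -Real.log (q i) + (∑ i, q i - ∑ i, p i) := by
        rw [Finset.sum_add_distrib, Finset.sum_sub_distrib]
    _ ≤ ∑ i, p i * -Real.log (q i) := by linarith

theorem shannonEntropy_eq_sum_mul_neg_log [Fintype ι] (φ : X → ι) :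
    shannonEntropy μ φ = ∑ i, μ.real (φ ⁻¹' {i}) * -Real.log (μ.real (φ ⁻¹' {i})) :=
  Finset.sum_congr rfl fun _ _ => neg_mul_comm _ _

section Discrete

variable [Fintype ι] [MeasurableSpace ι] [MeasurableSingletonClass ι]

theorem sum_measureReal_preimage_singleton_eq_one [IsProbabilityMeasure μ] {φ : X → ι}
    (hφ : Measurable φ) : ∑ i, μ.real (φ ⁻¹' {i}) = 1 := by
  rw [sum_measureReal_preimage_singleton _ fun i _ => hφ (measurableSet_singleton i)]
  simp

theorem sum_measureReal_preimage_singleton_mul_comp [Fintype κ] [IsFiniteMeasure μ] {φ : X → ι}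
    (hφ : Measurable φ) (g : ι → κ) (f : κ → ℝ) :
    ∑ i, μ.real (φ ⁻¹' {i}) * f (g i) = ∑ k, μ.real ((g ∘ φ) ⁻¹' {k}) * f k := by
  classical
  have hfiber : ∀ k, μ.real ((g ∘ φ) ⁻¹' {k}) = ∑ i with g i = k, μ.real (φ ⁻¹' {i}) := by
    intro k
    rw [sum_measureReal_preimage_singleton _ fun i _ => hφ (measurableSet_singleton i)]
    congr 1
    ext x
    simp
  rw [← Finset.sum_fiberwise _ g]
  refine Finset.sum_congr rfl fun k _ => ?_
  rw [hfiber, Finset.sum_mul]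
  exact Finset.sum_congr rfl fun i hi => by rw [(Finset.mem_filter.1 hi).2]

theorem shannonEntropy_comp_le [Fintype κ] [IsFiniteMeasure μ] {φ : X → ι} (hφ : Measurable φ)
    (g : ι → κ) : shannonEntropy μ (g ∘ φ) ≤ shannonEntropy μ φ := by
  rw [shannonEntropy_eq_sum_mul_neg_log, shannonEntropy_eq_sum_mul_neg_log,
    ← sum_measureReal_preimage_singleton_mul_comp hφ g fun k => -Real.log (μ.real (g ∘ φ ⁻¹' {k}))]
  refine Finset.sum_le_sum fun i _ => ?_
  rcases measureReal_nonneg.eq_or_lt with hzero | hpos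
  · rw [← hzero, zero_mul, zero_mul]
  · have hsub : φ ⁻¹' {i} ⊆ g ∘ φ ⁻¹' {g i} := fun x hx => congrArg g hx
    have hle := measureReal_mono (μ := μ) hsub
    gcongr

theorem shannonEntropy_le_of_factorsThrough [Fintype κ] [IsFiniteMeasure μ] {φ : X → κ}
    {ψ : X → ι} (hψ : Measurable ψ) (h : φ.FactorsThrough ψ) :
    shannonEntropy μ φ ≤ shannonEntropy μ ψ := by
  rcases isEmpty_or_nonempty X with hX | ⟨⟨x₀⟩⟩
  · simp [shannonEntropy, Set.eq_empty_of_isEmpty]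
  · have hφ : φ = Function.extend ψ φ (fun _ => φ x₀) ∘ ψ :=
      funext fun x => (h.extend_apply _ x).symm
    rw [hφ]
    exact shannonEntropy_comp_le hψ _

theorem neg_log_le_shannonEntropy [IsProbabilityMeasure μ] {φ : X → ι} (hφ : Measurable φ) {m : ℝ}
    (hm : ∀ i, μ.real (φ ⁻¹' {i}) ≤ m) : -Real.log m ≤ shannonEntropy μ φ := by
  calc -Real.log m = ∑ i, μ.real (φ ⁻¹' {i}) * -Real.log m := by
        rw [← Finset.sum_mul, sum_measureReal_preimage_singleton_eq_one hφ, one_mul]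
    _ ≤ ∑ i, μ.real (φ ⁻¹' {i}) * -Real.log (μ.real (φ ⁻¹' {i})) := by
        refine Finset.sum_le_sum fun i _ => ?_
        rcases measureReal_nonneg.eq_or_lt with hzero | hpos
        · rw [← hzero, zero_mul, zero_mul]
        · gcongr
          exact hm i
    _ = shannonEntropy μ φ := (shannonEntropy_eq_sum_mul_neg_log φ).symm

theorem shannonEntropy_le_log_card [IsProbabilityMeasure μ] {φ : X → ι} (hφ : Measurable φ) :
    shannonEntropy μ φ ≤ Real.log (Fintype.card ι) := by
  have hsum := sum_measureReal_preimage_singleton_eq_one (μ := μ) hφ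
  have : Nonempty ι := (nonempty_of_isProbabilityMeasure μ).map φ
  calc shannonEntropy μ φ ≤ ∑ i, μ.real (φ ⁻¹' {i}) * -Real.log (Fintype.card ι : ℝ)⁻¹ :=
        sum_negMulLog_le_sum_mul_neg_log (q := fun _ => (Fintype.card ι : ℝ)⁻¹)
          (fun _ => measureReal_nonneg) (fun _ => by positivity)
          (fun i h => absurd h (by positivity)) (by simp [hsum])
    _ = Real.log (Fintype.card ι) := by
        rw [← Finset.sum_mul, hsum, one_mul, Real.log_inv, neg_neg]

theorem shannonEntropy_prodMk_le [Fintype κ] [MeasurableSpace κ] [MeasurableSingletonClass κ]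
    [IsProbabilityMeasure μ] {φ : X → ι} {ψ : X → κ} (hφ : Measurable φ) (hψ : Measurable ψ) :
    shannonEntropy μ (fun x => (φ x, ψ x)) ≤ shannonEntropy μ φ + shannonEntropy μ ψ := by
  set r : ι × κ → ℝ := fun v => μ.real ((fun x => (φ x, ψ x)) ⁻¹' {v})
  set p : ι → ℝ := fun i => μ.real (φ ⁻¹' {i})
  set q : κ → ℝ := fun k => μ.real (ψ ⁻¹' {k})
  have hpair := hφ.prodMk hψ
  have hle_fst : ∀ v, r v ≤ p v.1 := fun v => measureReal_mono fun x hx => congrArg Prod.fst hx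
  have hle_snd : ∀ v, r v ≤ q v.2 := fun v => measureReal_mono fun x hx => congrArg Prod.snd hx
  have hr_nonneg : ∀ v, 0 ≤ r v := fun _ => measureReal_nonneg
  have hzero : ∀ v, p v.1 * q v.2 = 0 → r v = 0 := fun v h =>
    (hr_nonneg v).antisymm' <|
      (mul_eq_zero.1 h).elim (fun h => h ▸ hle_fst v) fun h => h ▸ hle_snd v
  have hsum : ∑ v : ι × κ, p v.1 * q v.2 ≤ ∑ v, r v := by
    rw [sum_measureReal_preimage_singleton_eq_one hpair, Fintype.sum_prod_type,
      ← Fintype.sum_mul_sum, sum_measureReal_preimage_singleton_eq_one hφ,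
      sum_measureReal_preimage_singleton_eq_one hψ, one_mul]
  calc shannonEntropy μ (fun x => (φ x, ψ x)) ≤ ∑ v, r v * -Real.log (p v.1 * q v.2) :=
        sum_negMulLog_le_sum_mul_neg_log hr_nonneg
          (fun _ => mul_nonneg measureReal_nonneg measureReal_nonneg) hzero hsum
    _ = ∑ v, (r v * -Real.log (p v.1) + r v * -Real.log (q v.2)) := by
        refine Finset.sum_congr rfl fun v _ => ?_
        rcases (hr_nonneg v).eq_or_lt with h | h
        · rw [← h, zero_mul, zero_mul, zero_mul, add_zero]
        · rw [Real.log_mul (h.trans_le (hle_fst v)).ne' (h.trans_le (hle_snd v)).ne']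
          ring
    _ = shannonEntropy μ φ + shannonEntropy μ ψ := by
        rw [Finset.sum_add_distrib, shannonEntropy_eq_sum_mul_neg_log,
          shannonEntropy_eq_sum_mul_neg_log]
        exact congrArg₂ _
          (sum_measureReal_preimage_singleton_mul_comp hpair Prod.fst fun i => -Real.log (p i))
          (sum_measureReal_preimage_singleton_mul_comp hpair Prod.snd fun k => -Real.log (q k))

theorem shannonEntropy_pi_le [IsProbabilityMeasure μ] {n : ℕ} {φ : X → Fin n → ι}
    (hφ : Measurable φ) : shannonEntropy μ φ ≤ ∑ k, shannonEntropy μ (fun x => φ x k) := by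
  induction n with
  | zero => simpa using shannonEntropy_le_log_card (μ := μ) hφ
  | succ n ih =>
    have hcoord : ∀ k, Measurable fun x => φ x k := measurable_pi_iff.1 hφ
    have htail : Measurable fun x (k : Fin n) => φ x k.succ :=
      measurable_pi_iff.2 fun k => hcoord k.succ
    calc shannonEntropy μ φ
        ≤ shannonEntropy μ (fun x => (φ x 0, fun k : Fin n => φ x k.succ)) :=
          shannonEntropy_le_of_factorsThrough ((hcoord 0).prodMk htail) fun x y h => by
            obtain ⟨hzero, hsucc⟩ := Prod.mk.inj h
            exact funext (Fin.cases hzero fun k => congrFun hsucc k)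
      _ ≤ _ := shannonEntropy_prodMk_le (hcoord 0) htail
      _ ≤ _ := by
          rw [Fin.sum_univ_succ]
          gcongr
          exact ih htail

theorem shannonEntropy_comp_measurePreserving {Y : Type*} [MeasurableSpace Y] {ν : Measure Y}
    {T : X → Y} (hT : MeasurePreserving T μ ν) {φ : Y → ι} (hφ : Measurable φ) :
    shannonEntropy μ (fun x => φ (T x)) = shannonEntropy ν φ :=
  Finset.sum_congr rfl fun i _ => congrArg _ <|
    hT.measureReal_preimage (hφ (measurableSet_singleton i)).nullMeasurableSet

theorem exists_forall_shannonEntropy_lt (i₀ : ι) {ε : ℝ} (hε : 0 < ε) :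
    ∃ δ > 0, ∀ {X : Type*} [MeasurableSpace X] (μ : Measure X) [IsProbabilityMeasure μ]
      {φ : X → ι}, Measurable φ → μ.real {x | φ x ≠ i₀} < δ → shannonEntropy μ φ < ε := by
  classical
  have hcont : Continuous fun p : ι → ℝ => ∑ i, Real.negMulLog (p i) := by fun_prop
  have hzero : ∑ i, Real.negMulLog ((Pi.single i₀ 1 : ι → ℝ) i) = 0 :=
    Finset.sum_eq_zero fun i _ => by rcases eq_or_ne i i₀ with rfl | hi <;> simp [*]
  obtain ⟨δ, hδ, hball⟩ := Metric.eventually_nhds_iff.1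
    ((hcont.tendsto (Pi.single i₀ 1)).eventually_lt_const (hzero.trans_lt hε))
  refine ⟨δ, hδ, fun {X} _ μ _ φ hφ hlt => hball ((dist_pi_lt_iff hδ).2 fun i => ?_)⟩
  rcases eq_or_ne i i₀ with rfl | hi
  · have hcompl : μ.real (φ ⁻¹' {i}) + μ.real {x | φ x ≠ i} = 1 :=
      probReal_add_probReal_compl (hφ (measurableSet_singleton i))
    rwa [Pi.single_eq_same, Real.dist_eq, sub_eq_iff_eq_add'.2 (eq_sub_of_add_eq hcompl), abs_neg,
      abs_of_nonneg measureReal_nonneg]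
  · have hsub : φ ⁻¹' {i} ⊆ {x | φ x ≠ i₀} := fun x hx h => hi (hx.symm.trans h)
    rw [Pi.single_eq_of_ne hi, Real.dist_eq, sub_zero, abs_of_nonneg measureReal_nonneg]
    exact (measureReal_mono hsub).trans_lt hlt

end Discrete

end Entropy

section BlockCoding

variable {X : Type*}

/-- A coding of the orbits of `T` by successive blocks: `x` is at position `o x` of its current
block, and the current and the following blocks have lengths `h + z x 0, h + z x 1, …`. -/
structure BlockCoding (T : X → X) (h L : ℕ) (o : X → ℕ) (z : X → ℕ → ℕ) : Prop where
  gap_lt : ∀ x i, z x i < L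
  offset_lt : ∀ x, o x < h + z x 0
  step : ∀ x, o x + 1 < h + z x 0 → o (T x) = o x + 1 ∧ z (T x) = z x
  wrap : ∀ x, o x + 1 = h + z x 0 → o (T x) = 0 ∧ z (T x) = fun i => z x (i + 1)

/-- In a block coding with offset function `o` and block lengths `h + z`, exactly `i` blocks have
been left after `t` steps from `x`. -/
structure Crosses (T : X → X) (h : ℕ) (o : X → ℕ) (z : X → ℕ → ℕ) (x : X) (t i : ℕ) : Prop where
  gap_iterate : ∀ l, z (T^[t] x) l = z x (i + l)
  offset_add : o x + t = o (T^[t] x) + ∑ l ∈ Finset.range i, (h + z x l)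

/-- `ψ` is the offset function of a block coding with block height `b` that refines into the
coding with offset function `o` and block height `h`. -/
structure OffsetFactor (h b : ℕ) (o ψ : X → ℕ) : Prop where
  eq_add : ∀ x y d, o x = o y + d → d ≤ ψ x → ψ x = ψ y + d
  le_of_le : ∀ x, h ≤ o x → b ≤ ψ x

variable {T : X → X} {h L : ℕ} {o : X → ℕ} {z : X → ℕ → ℕ} {x y : X}

namespace Crosses

theorem zero (x : X) : Crosses T h o z x 0 0 := ⟨by simp, by simp⟩

theorem trans {s t i j : ℕ} (hs : Crosses T h o z x s i) (ht : Crosses T h o z (T^[s] x) t j) :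
    Crosses T h o z x (s + t) (i + j) := by
  have hT : T^[s + t] x = T^[t] (T^[s] x) := by rw [add_comm, Function.iterate_add_apply]
  refine ⟨fun l => by rw [hT, ht.gap_iterate, hs.gap_iterate, add_assoc], ?_⟩
  have hsum := ht.offset_add
  simp_rw [hs.gap_iterate] at hsum
  rw [hT, Finset.sum_range_add, ← add_assoc, hs.offset_add]
  lia

theorem mul_le {t i : ℕ} (hx : Crosses T h o z x t i) : i * h ≤ o x + t := by
  calc i * h = ∑ _l ∈ Finset.range i, h := by simp
    _ ≤ ∑ l ∈ Finset.range i, (h + z x l) := Finset.sum_le_sum fun _ _ => Nat.le_add_right _ _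
    _ ≤ o x + t := hx.offset_add ▸ Nat.le_add_left _ _

theorem add_lt_sum (hc : BlockCoding T h L o z) {t i : ℕ} (hx : Crosses T h o z x t i) :
    o x + t < ∑ l ∈ Finset.range (i + 1), (h + z x l) := by
  have hlt := hc.offset_lt (T^[t] x)
  rw [hx.gap_iterate, add_zero] at hlt
  rw [hx.offset_add, Finset.sum_range_succ, add_comm]
  lia

theorem lt_mul (hc : BlockCoding T h L o z) {t i : ℕ} (hx : Crosses T h o z x t i) :
    t < (i + 1) * (h + L) := by
  calc t ≤ o x + t := Nat.le_add_left _ _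
    _ < ∑ l ∈ Finset.range (i + 1), (h + z x l) := hx.add_lt_sum hc
    _ ≤ ∑ _l ∈ Finset.range (i + 1), (h + L) :=
        Finset.sum_le_sum fun l _ => Nat.add_le_add_left (hc.gap_lt x l).le h
    _ = (i + 1) * (h + L) := by simp

theorem lt_two (hc : BlockCoding T h L o z) {t i : ℕ} (ht : t ≤ h)
    (hx : Crosses T h o z x t i) : i < 2 := by
  by_contra! hi
  have hsum : h + z x 0 + (h + z x 1) ≤ ∑ l ∈ Finset.range i, (h + z x l) := by
    rw [← Finset.sum_range_one fun l => h + z x l, ← Finset.sum_range_succ]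
    exact Finset.sum_le_sum_of_subset (Finset.range_subset_range.2 hi)
  have := hx.offset_add
  have := hc.offset_lt x
  lia

theorem le_of_gaps_eq (hc : BlockCoding T h L o z) {t i j : ℕ} (hx : Crosses T h o z x t i)
    (hy : Crosses T h o z y t j) (ho : o x = o y) (hz : ∀ l ≤ i, z x l = z y l) : j ≤ i := by
  by_contra! hij
  have hlt := hx.add_lt_sum hc
  rw [Finset.sum_congr rfl fun l hl => by rw [hz l (Nat.lt_succ_iff.1 (Finset.mem_range.1 hl))]]
    at hlt
  have hle : ∑ l ∈ Finset.range (i + 1), (h + z y l) ≤ ∑ l ∈ Finset.range j, (h + z y l) :=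
    Finset.sum_le_sum_of_subset (Finset.range_subset_range.2 hij)
  have := hy.offset_add
  lia

theorem offset_iterate_eq {t i : ℕ} (hx : Crosses T h o z x t i) (hy : Crosses T h o z y t i)
    (ho : o x = o y) (hz : ∀ l < i, z x l = z y l) : o (T^[t] x) = o (T^[t] y) := by
  have hsum : ∑ l ∈ Finset.range i, (h + z x l) = ∑ l ∈ Finset.range i, (h + z y l) :=
    Finset.sum_congr rfl fun l hl => by rw [hz l (Finset.mem_range.1 hl)]
  have := hx.offset_add
  have := hy.offset_add
  lia

theorem le_iterate_of_crosses_one {t : ℕ} (hx : Crosses T h o z x t 0)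
    (hy : Crosses T h o z y t 1) (ho : o x = o y) : h ≤ o (T^[t] x) := by
  have hx := hx.offset_add
  have hy := hy.offset_add
  simp only [Finset.range_zero, Finset.sum_empty, Finset.sum_range_one, add_zero] at hx hy
  lia

end Crosses

namespace OffsetFactor

theorem eq_of_abs_sub_le {b m : ℕ} {ψ : X → ℕ} (hψ : OffsetFactor h b o ψ)
    (heq : ψ x = ψ y) (hx : o x ≤ o y + m) (hy : o y ≤ o x + m) (hm : m ≤ ψ x) : o x = o y := by
  rcases le_total (o y) (o x) with hle | hle
  · have := hψ.eq_add x y (o x - o y) (by lia) (by lia)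
    lia
  · have := hψ.eq_add y x (o y - o x) (by lia) (by lia)
    lia

end OffsetFactor

namespace BlockCoding

theorem step_or_wrap (hc : BlockCoding T h L o z) (x : X) :
    (o x + 1 < h + z x 0 ∧ o (T x) = o x + 1 ∧ z (T x) = z x) ∨
      (o x + 1 = h + z x 0 ∧ o (T x) = 0 ∧ z (T x) = fun i => z x (i + 1)) :=
  (Nat.succ_le_of_lt (hc.offset_lt x)).lt_or_eq.imp (fun hlt => ⟨hlt, hc.step x hlt⟩)
    fun heq => ⟨heq, hc.wrap x heq⟩

theorem offset_apply_of_pos (hc : BlockCoding T h L o z) (hpos : 0 < o (T x)) :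
    o (T x) = o x + 1 := by
  rcases hc.step_or_wrap x with ⟨-, ho, -⟩ | ⟨-, ho, -⟩ <;> lia

theorem exists_crosses (hc : BlockCoding T h L o z) (x : X) (t : ℕ) :
    ∃ i, Crosses T h o z x t i := by
  induction t with
  | zero => exact ⟨0, .zero x⟩
  | succ t ih =>
    obtain ⟨i, hi⟩ := ih
    suffices ∃ j, Crosses T h o z (T^[t] x) 1 j from this.imp' (i + ·) fun j hj => hi.trans hj
    rcases hc.step_or_wrap (T^[t] x) with ⟨-, ho, hz⟩ | ⟨hlen, ho, hz⟩
    · exact ⟨0, by simp [hz], by simp [ho]⟩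
    · exact ⟨1, by simp [hz, add_comm], by simp [ho, hlen]⟩

theorem offset_iterate_eq (hc : BlockCoding T h L o z) {t W : ℕ} (ho : o x = o y)
    (hz : ∀ l < W, z x l = z y l) (hW : h + L + t ≤ W * h) : o (T^[t] x) = o (T^[t] y) := by
  have hlt : o x < h + L := (hc.offset_lt x).trans (Nat.add_lt_add_left (hc.gap_lt x 0) h)
  obtain ⟨i, hi⟩ := hc.exists_crosses x t
  obtain ⟨j, hj⟩ := hc.exists_crosses y t
  have hiW : i < W := lt_of_mul_lt_mul_right (hi.mul_le.trans_lt (by lia)) (Nat.zero_le h)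
  have hjW : j < W := lt_of_mul_lt_mul_right (hj.mul_le.trans_lt (by lia)) (Nat.zero_le h)
  obtain rfl : i = j := le_antisymm
    (hj.le_of_gaps_eq hc hi ho.symm fun l hl => (hz l (by lia)).symm)
    (hi.le_of_gaps_eq hc hj ho fun l hl => hz l (by lia))
  exact hi.offset_iterate_eq hj ho fun l hl => hz l (by lia)

theorem offsetFactor {b : ℕ} {ψ : X → ℕ} {z' : X → ℕ → ℕ} (hT : T.Surjective)
    (hc : BlockCoding T h L o z) (hc' : BlockCoding T b L ψ z') (hle : ∀ x, ψ x ≤ o x)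
    (hcomp : ψ.FactorsThrough o) (htop : ∀ x, h ≤ o x → b ≤ ψ x) : OffsetFactor h b o ψ := by
  refine ⟨fun x y d => ?_, htop⟩
  induction d generalizing x with
  | zero => exact fun heq _ => hcomp heq
  | succ d ih =>
    intro heq hd
    obtain ⟨w, rfl⟩ := hT x
    have hψ := hc'.offset_apply_of_pos (x := w) (by lia)
    have ho := hc.offset_apply_of_pos (x := w) ((by lia : 0 < ψ (T w)).trans_le (hle _))
    have := ih w (by lia) (by lia)
    lia

/-- Two points that agree on `o` drift apart by less than `L` when they leave a block, so away from
the ends of its blocks the coarse offset `ψ` tells the time of leaving, hence the block length. -/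
theorem exists_common_crosses_of_le (hc : BlockCoding T h L o z) {b : ℕ} {ψ : X → ℕ}
    (hψ : OffsetFactor h b o ψ) {t : ℕ} (ht : t ≤ h) (ho : o x = o y)
    (hobs : ψ (T^[t] x) = ψ (T^[t] y))
    (hend : ψ (T^[t] x) < L ∨ b ≤ ψ (T^[t] x) → z x 0 = z y 0) :
    ∃ i, Crosses T h o z x t i ∧ Crosses T h o z y t i ∧ ∀ l < i, z x l = z y l := by
  obtain ⟨i, hi⟩ := hc.exists_crosses x t
  obtain ⟨j, hj⟩ := hc.exists_crosses y t
  have hi2 := hi.lt_two hc ht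
  have hj2 := hj.lt_two hc ht
  by_cases hnear : ψ (T^[t] x) < L ∨ b ≤ ψ (T^[t] x)
  · have hz := hend hnear
    obtain rfl : i = j := by
      refine le_antisymm ?_ ?_ <;> by_contra! hlt
      · obtain rfl : j = 0 := by lia
        have := hj.le_of_gaps_eq hc hi ho.symm fun l hl => by rw [Nat.le_zero.1 hl, hz]
        lia
      · obtain rfl : i = 0 := by lia
        have := hi.le_of_gaps_eq hc hj ho fun l hl => by rw [Nat.le_zero.1 hl, hz]
        lia
    exact ⟨i, hi, hj, fun l hl => by rwa [show l = 0 by lia]⟩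
  · rw [not_or, not_lt, not_le] at hnear
    interval_cases i <;> interval_cases j
    · exact ⟨0, hi, hj, by simp⟩
    · exact absurd (hψ.le_of_le _ (hi.le_iterate_of_crosses_one hj ho)) hnear.2.not_ge
    · exact absurd (hψ.le_of_le _ (hj.le_iterate_of_crosses_one hi ho.symm))
        (hobs ▸ hnear.2).not_ge
    · refine ⟨1, hi, hj, fun l hl => ?_⟩
      have hx := hi.offset_add
      have hy := hj.offset_add
      have := hc.gap_lt x 0
      have := hc.gap_lt y 0
      rw [Finset.sum_range_one] at hx hy
      have heq := hψ.eq_of_abs_sub_le hobs (m := L) (by lia) (by lia) hnear.1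
      rw [show l = 0 by lia]
      lia

theorem exists_common_crosses (hc : BlockCoding T h L o z) {b : ℕ} {ψ : X → ℕ}
    (hψ : OffsetFactor h b o ψ) {t : ℕ → ℕ} (ht0 : t 0 = 0) (hmono : Monotone t) (N : ℕ)
    (hstep : ∀ k < N, t (k + 1) ≤ t k + h) (ho : o x = o y)
    (hobs : ∀ k < N, ψ (T^[t (k + 1)] x) = ψ (T^[t (k + 1)] y))
    (hend : ∀ k < N, ψ (T^[t (k + 1)] x) < L ∨ b ≤ ψ (T^[t (k + 1)] x) →
      z (T^[t k] x) 0 = z (T^[t k] y) 0) :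
    ∃ i, Crosses T h o z x (t N) i ∧ Crosses T h o z y (t N) i ∧ ∀ l < i, z x l = z y l := by
  induction N with
  | zero => exact ⟨0, by rw [ht0]; exact .zero x, by rw [ht0]; exact .zero y, by simp⟩
  | succ N ih =>
    obtain ⟨i, hx, hy, hz⟩ := ih (fun k hk => hstep k (by lia)) (fun k hk => hobs k (by lia))
      fun k hk => hend k (by lia)
    have hsplit : t N + (t (N + 1) - t N) = t (N + 1) :=
      Nat.add_sub_cancel' (hmono (Nat.le_succ N))
    have hT : ∀ w : X, T^[t (N + 1)] w = T^[t (N + 1) - t N] (T^[t N] w) := fun w => by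
      rw [← Function.iterate_add_apply, Nat.sub_add_cancel (hmono (Nat.le_succ N))]
    have hobsN := hobs N N.lt_succ_self
    have hendN := hend N N.lt_succ_self
    simp only [hT] at hobsN hendN
    obtain ⟨j, hjx, hjy, hzj⟩ := hc.exists_common_crosses_of_le hψ
      (Nat.sub_le_iff_le_add'.2 (hstep N N.lt_succ_self)) (hx.offset_iterate_eq hy ho hz)
      hobsN hendN
    refine ⟨i + j, hsplit ▸ hx.trans hjx, hsplit ▸ hy.trans hjy, fun l hl => ?_⟩
    rcases lt_or_ge l i with hli | hil
    · exact hz l hli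
    · have hgap := hzj (l - i) (by lia)
      rwa [hx.gap_iterate, hy.gap_iterate, Nat.add_sub_cancel' hil] at hgap

end BlockCoding

end BlockCoding

section WordSeq

/-- The sequence obtained by concatenating all words of length `M` over `{0, …, L - 1}`, the `w`-th
word being the base `L` expansion of `w`, lowest digit first; from `w = L ^ M` on it repeats. -/
def wordSeq (L M i : ℕ) : ℕ := i / M / L ^ (i % M) % L

variable {L M : ℕ}

theorem mod_pow_eq_of_digits_eq {u v k : ℕ} (h : ∀ p < k, u / L ^ p % L = v / L ^ p % L) :
    u % L ^ k = v % L ^ k := by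
  induction k with
  | zero => simp [Nat.mod_one]
  | succ k ih => rw [Nat.mod_pow_succ, Nat.mod_pow_succ, ih fun p hp => h p (by lia), h k (by lia)]

theorem wordSeq_mul_add (w : ℕ) {p : ℕ} (hp : p < M) :
    wordSeq L M (M * w + p) = w / L ^ p % L := by
  rw [wordSeq, Nat.mul_add_div (by lia), Nat.mul_add_mod, Nat.div_eq_of_lt hp, Nat.mod_eq_of_lt hp,
    add_zero]

/-- A window of length `M` starting at position `s` of the `w`-th word shows the upper digits of `w`
and then the lower digits of `w + 1`. -/
theorem modEq_of_wordSeq_window_eq {s w w' : ℕ} (hs : s < M)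
    (hw : ∀ i < M, wordSeq L M (M * w + s + i) = wordSeq L M (M * w' + s + i)) :
    w ≡ w' [MOD L ^ M] := by
  have hupper : ∀ u, ∀ p < M - s, wordSeq L M (M * u + s + p) = u / L ^ s / L ^ p % L := by
    intro u p hp
    rw [add_assoc, wordSeq_mul_add u (by lia), Nat.div_div_eq_div_mul, pow_add]
  have hlower : ∀ u, ∀ p < s, wordSeq L M (M * u + s + (M - s + p)) = (u + 1) / L ^ p % L := by
    intro u p hp
    rw [← wordSeq_mul_add (u + 1) (hp.trans hs), mul_add]
    congr 1
    lia
  have hdiv : w / L ^ s % L ^ (M - s) = w' / L ^ s % L ^ (M - s) :=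
    mod_pow_eq_of_digits_eq fun p hp => by rw [← hupper w p hp, ← hupper w' p hp, hw p (by lia)]
  have hmod : w % L ^ s = w' % L ^ s :=
    Nat.ModEq.add_right_cancel' 1 <| mod_pow_eq_of_digits_eq fun p hp => by
      rw [← hlower w p hp, ← hlower w' p hp, hw _ (by lia)]
  rw [Nat.ModEq, ← Nat.add_sub_cancel' hs.le, pow_add, Nat.mod_mul, Nat.mod_mul, hdiv, hmod]

theorem card_le_of_wordSeq_window_eq {B : ℕ} (hM : 0 < M) (v : ℕ → ℕ) (s : Finset ℕ)
    (hB : ∀ c ∈ s, c < B) (hv : ∀ c ∈ s, ∀ i < M, wordSeq L M (c + i) = v i) :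
    s.card ≤ M * (B / (M * L ^ M) + 1) := by
  have hmaps : Set.MapsTo (fun c => (c % M, c / M / L ^ M)) s
      (Finset.range M ×ˢ Finset.range (B / (M * L ^ M) + 1) : Finset (ℕ × ℕ)) := fun c hc => by
    simp only [Finset.coe_product, Set.mem_prod, Finset.mem_coe, Finset.mem_range]
    exact ⟨Nat.mod_lt _ hM, Nat.lt_succ_of_le <|
      Nat.div_div_eq_div_mul c M _ ▸ Nat.div_le_div_right (hB c hc).le⟩
  have hinj : Set.InjOn (fun c => (c % M, c / M / L ^ M)) s := by
    intro c hc d hd hcd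
    obtain ⟨hmod, hdiv⟩ := Prod.mk.inj hcd
    have hword : c / M ≡ d / M [MOD L ^ M] :=
      modEq_of_wordSeq_window_eq (Nat.mod_lt c hM) fun i hi => by
        rw [Nat.div_add_mod, hmod, Nat.div_add_mod, hv c hc i hi, hv d hd i hi]
    have : c / M = d / M := Nat.div_add_mod (c / M) (L ^ M) ▸ hword ▸ hdiv ▸ Nat.div_add_mod _ _
    rw [← Nat.div_add_mod c M, hmod, this, Nat.div_add_mod]
  simpa using Finset.card_le_card_of_injOn _ hmaps hinj

end WordSeq

section Skyscraper

variable {Y : Type*}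

/-- The skyscraper with floors `0, …, s y` over `y`, on which Kakutani towers are built. -/
abbrev Skyscraper (s : Y → ℕ) : Type _ := {p : Y × ℕ // p.2 ≤ s p.1}

namespace Skyscraper

variable {s : Y → ℕ}

/-- The Kakutani tower map over `S`: one floor up, and from the top floor over `y` to the ground
floor over `S y`. -/
def shift (S : Equiv.Perm Y) (s : Y → ℕ) : Equiv.Perm (Skyscraper s) where
  toFun x := if h : x.1.2 < s x.1.1 then ⟨(x.1.1, x.1.2 + 1), h⟩ else ⟨(S x.1.1, 0), Nat.zero_le _⟩
  invFun x := if x.1.2 = 0 then ⟨(S.symm x.1.1, s (S.symm x.1.1)), le_rfl⟩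
    else ⟨(x.1.1, x.1.2 - 1), (Nat.sub_le _ _).trans x.2⟩
  left_inv := by
    rintro ⟨⟨y, j⟩, hj : j ≤ s y⟩
    rcases hj.lt_or_eq with h | rfl
    · simp [h]
    · simp
  right_inv := by
    rintro ⟨⟨y, _ | j⟩, hj⟩
    · simp
    · simp [Nat.lt_of_succ_le hj]

theorem shift_apply_of_lt (S : Equiv.Perm Y) {x : Skyscraper s} (h : x.1.2 < s x.1.1) :
    shift S s x = ⟨(x.1.1, x.1.2 + 1), h⟩ :=
  dif_pos h

theorem shift_apply_of_eq (S : Equiv.Perm Y) {x : Skyscraper s} (h : x.1.2 = s x.1.1) :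
    shift S s x = ⟨(S x.1.1, 0), Nat.zero_le _⟩ :=
  dif_neg h.not_lt

/-- The set of base points over which `B` contains the floor `j`. -/
def floorSection (B : Set (Skyscraper s)) (j : ℕ) : Set Y :=
  {y | ∃ h : j ≤ s y, (⟨(y, j), h⟩ : Skyscraper s) ∈ B}

theorem floorSection_eq_preimage_image (B : Set (Skyscraper s)) (j : ℕ) :
    floorSection B j = (fun y => (y, j)) ⁻¹' (Subtype.val '' B) := by
  ext y
  simp [floorSection]

theorem floorSection_univ (j : ℕ) :
    floorSection (Set.univ : Set (Skyscraper s)) j = {y | j ≤ s y} := by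
  simp [floorSection]

theorem floorSection_preimage_fst (A : Set Y) (j : ℕ) :
    floorSection {x : Skyscraper s | x.1.1 ∈ A} j = {y | j ≤ s y} ∩ A := by
  ext y
  simp [floorSection]

theorem floorSection_preimage_shift (S : Equiv.Perm Y) (B : Set (Skyscraper s)) (j : ℕ) :
    floorSection (shift S s ⁻¹' B) j =
      floorSection B (j + 1) ∪ (s ⁻¹' {j} ∩ S ⁻¹' floorSection B 0) := by
  ext y
  constructor
  · rintro ⟨h, hx⟩
    rcases h.lt_or_eq with hlt | heq
    · rw [Set.mem_preimage, shift_apply_of_lt S hlt] at hx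
      exact Or.inl ⟨hlt, hx⟩
    · rw [Set.mem_preimage, shift_apply_of_eq S heq] at hx
      exact Or.inr ⟨heq.symm, Nat.zero_le _, hx⟩
  · rintro (⟨h, hx⟩ | ⟨rfl : s y = j, _, hx⟩)
    · refine ⟨(Nat.le_succ j).trans h, ?_⟩
      rwa [Set.mem_preimage, shift_apply_of_lt S (by exact h)]
    · refine ⟨le_rfl, ?_⟩
      rwa [Set.mem_preimage, shift_apply_of_eq S rfl]

theorem floorSection_preimage_shift_symm_zero (S : Equiv.Perm Y) (B : Set (Skyscraper s)) :
    floorSection ((shift S s).symm ⁻¹' B) 0 = S.symm ⁻¹' ⋃ i, s ⁻¹' {i} ∩ floorSection B i := by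
  ext y
  simp [floorSection, shift]

theorem floorSection_preimage_shift_symm_succ (S : Equiv.Perm Y) (B : Set (Skyscraper s))
    (j : ℕ) :
    floorSection ((shift S s).symm ⁻¹' B) (j + 1) = floorSection B j ∩ {y | j + 1 ≤ s y} := by
  ext y
  constructor
  · rintro ⟨h, hx⟩
    exact ⟨⟨(Nat.le_succ j).trans h, hx⟩, h⟩
  · rintro ⟨⟨_, hx⟩, h⟩
    exact ⟨h, hx⟩

variable [MeasurableSpace Y]

theorem measurableSet_skyscraper (hs : Measurable s) :
    MeasurableSet {p : Y × ℕ | p.2 ≤ s p.1} :=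
  measurableSet_le measurable_snd (hs.comp measurable_fst)

theorem measurableSet_floorSection (hs : Measurable s) {B : Set (Skyscraper s)}
    (hB : MeasurableSet B) (j : ℕ) : MeasurableSet (floorSection B j) := by
  rw [floorSection_eq_preimage_image]
  exact measurable_prodMk_right ((measurableSet_skyscraper hs).subtype_image hB)

theorem measurable_of_measurableSet_floorSection {Z : Type*} [MeasurableSpace Z]
    {f : Skyscraper s → Z}
    (hf : ∀ C, MeasurableSet C → ∀ j, MeasurableSet (floorSection (f ⁻¹' C) j)) :
    Measurable f := by
  intro C hC
  have union_floors :
      f ⁻¹' C = Subtype.val ⁻¹' ⋃ j, floorSection (f ⁻¹' C) j ×ˢ ({j} : Set ℕ) := by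
    ext ⟨⟨y, j⟩, h : j ≤ s y⟩
    simp [floorSection, h]
  rw [union_floors]
  exact measurable_subtype_coe (MeasurableSet.iUnion fun j =>
    (hf C hC j).prod (measurableSet_singleton j))

/-- The Kakutani tower map as a measurable equivalence. -/
def measurableShift (S : Y ≃ᵐ Y) (hs : Measurable s) : Skyscraper s ≃ᵐ Skyscraper s where
  toEquiv := shift S.toEquiv s
  measurable_toFun := measurable_of_measurableSet_floorSection fun C hC j => by
    rw [floorSection_preimage_shift]
    exact (measurableSet_floorSection hs hC _).union ((hs (measurableSet_singleton j)).inter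
      (S.measurable (measurableSet_floorSection hs hC 0)))
  measurable_invFun := measurable_of_measurableSet_floorSection fun C hC j => by
    cases j with
    | zero =>
      rw [floorSection_preimage_shift_symm_zero]
      exact S.symm.measurable (MeasurableSet.iUnion fun i =>
        (hs (measurableSet_singleton i)).inter (measurableSet_floorSection hs hC i))
    | succ j =>
      rw [floorSection_preimage_shift_symm_succ]
      exact (measurableSet_floorSection hs hC j).inter (measurableSet_le measurable_const hs)

/-- The measure on the skyscraper whose restriction to each floor is a copy of `ν`. -/
def floorMeasure (ν : Measure Y) (s : Y → ℕ) : Measure (Skyscraper s) :=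
  (ν.prod Measure.count).comap Subtype.val

/-- The normalization of `floorMeasure ν s` to a probability measure. -/
def probMeasure (ν : Measure Y) (s : Y → ℕ) : Measure (Skyscraper s) :=
  (floorMeasure ν s Set.univ)⁻¹ • floorMeasure ν s

theorem measure_floorSection_preimage_shift (ν : Measure Y) {S : Y ≃ᵐ Y} (hs : Measurable s)
    {B : Set (Skyscraper s)} (hB : MeasurableSet B) (j : ℕ) :
    ν (floorSection (measurableShift S hs ⁻¹' B) j) =
      ν (floorSection B (j + 1)) + ν (s ⁻¹' {j} ∩ S ⁻¹' floorSection B 0) := by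
  have floors : floorSection (measurableShift S hs ⁻¹' B) j =
      floorSection B (j + 1) ∪ (s ⁻¹' {j} ∩ S ⁻¹' floorSection B 0) :=
    floorSection_preimage_shift S.toEquiv B j
  rw [floors, measure_union _ ((hs (measurableSet_singleton j)).inter
    (S.measurable (measurableSet_floorSection hs hB 0)))]
  rw [Set.disjoint_left]
  rintro y ⟨h, _⟩ ⟨rfl : s y = j, _⟩
  exact absurd h (Nat.not_succ_le_self _)

section SFinite

variable {ν : Measure Y} [SFinite ν]

theorem floorMeasure_apply (hs : Measurable s) {B : Set (Skyscraper s)} (hB : MeasurableSet B) :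
    floorMeasure ν s B = ∑' j, ν (floorSection B j) := by
  have comap_apply : floorMeasure ν s B = (ν.prod Measure.count) (Subtype.val '' B) :=
    (MeasurableEmbedding.subtype_coe (measurableSet_skyscraper hs)).comap_apply _ _
  have measurable_image : MeasurableSet (Subtype.val '' B : Set (Y × ℕ)) :=
    (measurableSet_skyscraper hs).subtype_image hB
  rw [comap_apply, Measure.prod_apply_symm measurable_image, lintegral_count]
  simp only [floorSection_eq_preimage_image]

theorem measurePreserving_floorMeasure {S : Y ≃ᵐ Y} (hS : MeasurePreserving S ν ν)
    (hs : Measurable s) :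
    MeasurePreserving (measurableShift S hs) (floorMeasure ν s) (floorMeasure ν s) := by
  refine ⟨(measurableShift S hs).measurable, Measure.ext fun B hB => ?_⟩
  have hB₀ := measurableSet_floorSection hs hB 0
  have ground_floor :
      ∑' j, ν (s ⁻¹' {j} ∩ S ⁻¹' floorSection B 0) = ν (floorSection B 0) := by
    rw [← hS.measure_preimage hB₀.nullMeasurableSet, ← measure_iUnion]
    · congr 1
      ext y
      simp
    · exact fun i j hij => Disjoint.inter_left _ (Disjoint.inter_right _
        (Disjoint.preimage _ (by simpa using hij)))
    · exact fun j => (hs (measurableSet_singleton j)).inter (S.measurable hB₀)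
  calc Measure.map (measurableShift S hs) (floorMeasure ν s) B
      = ∑' j, ν (floorSection (measurableShift S hs ⁻¹' B) j) := by
        rw [Measure.map_apply (measurableShift S hs).measurable hB,
          floorMeasure_apply hs ((measurableShift S hs).measurable hB)]
    _ = ν (floorSection B 0) + ∑' j, ν (floorSection B (j + 1)) := by
        simp_rw [measure_floorSection_preimage_shift ν hs hB]
        rw [ENNReal.tsum_add, ground_floor, add_comm]
    _ = floorMeasure ν s B := by
        rw [floorMeasure_apply hs hB]
        exact (tsum_eq_zero_add' (f := fun j => ν (floorSection B j)) ENNReal.summable).symm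

theorem measurePreserving_probMeasure {S : Y ≃ᵐ Y} (hS : MeasurePreserving S ν ν)
    (hs : Measurable s) :
    MeasurePreserving (measurableShift S hs) (probMeasure ν s) (probMeasure ν s) :=
  (measurePreserving_floorMeasure hS hs).smul_measure _

theorem floorMeasure_preimage_fst_le (hs : Measurable s) {b : ℕ} (hb : ∀ y, s y < b)
    {A : Set Y} (hA : MeasurableSet A) :
    floorMeasure ν s {x | x.1.1 ∈ A} ≤ b * ν A := by
  have measurable_preimage : MeasurableSet {x : Skyscraper s | x.1.1 ∈ A} :=
    (measurable_fst.comp measurable_subtype_coe) hA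
  rw [floorMeasure_apply hs measurable_preimage]
  simp_rw [floorSection_preimage_fst]
  have empty_floors : ∀ j ∉ Finset.range b, ν ({y | j ≤ s y} ∩ A) = 0 := by
    intro j hj
    have : {y | j ≤ s y} = ∅ := Set.eq_empty_of_forall_notMem fun y (hy : j ≤ s y) =>
      hj (Finset.mem_range.2 (hy.trans_lt (hb y)))
    rw [this, Set.empty_inter, measure_empty]
  rw [tsum_eq_sum empty_floors]
  calc ∑ j ∈ Finset.range b, ν ({y | j ≤ s y} ∩ A) ≤ ∑ _j ∈ Finset.range b, ν A :=
        Finset.sum_le_sum fun j _ => measure_mono Set.inter_subset_right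
    _ = b * ν A := by simp

theorem measure_univ_le_floorMeasure_univ (hs : Measurable s) :
    ν Set.univ ≤ floorMeasure ν s Set.univ := by
  rw [floorMeasure_apply hs MeasurableSet.univ]
  simpa [floorSection_univ] using ENNReal.le_tsum (f := fun j => ν {y | j ≤ s y}) 0

end SFinite

variable {ν : Measure Y} [IsProbabilityMeasure ν]

theorem isProbabilityMeasure_probMeasure (hs : Measurable s) {b : ℕ} (hb : ∀ y, s y < b) :
    IsProbabilityMeasure (probMeasure ν s) := by
  have one_le : 1 ≤ floorMeasure ν s Set.univ :=
    measure_univ (μ := ν) ▸ measure_univ_le_floorMeasure_univ hs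
  have le_b : floorMeasure ν s Set.univ ≤ b := by
    simpa using floorMeasure_preimage_fst_le (ν := ν) hs hb MeasurableSet.univ
  exact ⟨ENNReal.inv_mul_cancel (zero_lt_one.trans_le one_le).ne'
    (le_b.trans_lt (ENNReal.natCast_lt_top b)).ne⟩

theorem probMeasure_real_preimage_fst_le (hs : Measurable s) {b : ℕ} (hb : ∀ y, s y < b)
    {A : Set Y} (hA : MeasurableSet A) :
    (probMeasure ν s).real {x | x.1.1 ∈ A} ≤ b * ν.real A := by
  have inv_le_one : (floorMeasure ν s Set.univ)⁻¹ ≤ 1 :=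
    ENNReal.inv_le_one.2 (measure_univ (μ := ν) ▸ measure_univ_le_floorMeasure_univ hs)
  have le_mul : probMeasure ν s {x | x.1.1 ∈ A} ≤ b * ν A :=
    (mul_le_of_le_one_left zero_le inv_le_one).trans (floorMeasure_preimage_fst_le hs hb hA)
  have := ENNReal.toReal_mono (by finiteness) le_mul
  simpa [measureReal_def] using this

end Skyscraper

end Skyscraper

section PadicInt

variable {p : ℕ} [Fact p.Prime]

instance : MeasurableSpace ℤ_[p] := borel _

instance : BorelSpace ℤ_[p] := ⟨rfl⟩

/-- The residue in `{0, …, p ^ n - 1}` of a `p`-adic integer modulo `p ^ n`. -/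
def residue (n : ℕ) (z : ℤ_[p]) : ℕ := (PadicInt.toZModPow n z).val

theorem residue_lt (n : ℕ) (z : ℤ_[p]) : residue n z < p ^ n :=
  have : NeZero p := ⟨(Fact.out : p.Prime).ne_zero⟩
  ZMod.val_lt _

theorem residue_natCast (n m : ℕ) : residue n (m : ℤ_[p]) = m % p ^ n := by
  rw [residue, map_natCast, ZMod.val_natCast]

theorem residue_add_natCast (n : ℕ) (z : ℤ_[p]) (m : ℕ) :
    residue n (z + (m : ℤ_[p])) = (residue n z + m) % p ^ n := by
  have : NeZero p := ⟨(Fact.out : p.Prime).ne_zero⟩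
  rw [residue, map_add, map_natCast, ZMod.val_add, ZMod.val_natCast, Nat.add_mod_mod, residue]

theorem residue_add_one_of_lt {n : ℕ} {z : ℤ_[p]} (h : residue n z + 1 < p ^ n) :
    residue n (z + 1) = residue n z + 1 := by
  rw [← Nat.cast_one, residue_add_natCast, Nat.mod_eq_of_lt h]

theorem residue_add_one_of_eq {n : ℕ} {z : ℤ_[p]} (h : residue n z + 1 = p ^ n) :
    residue n (z + 1) = 0 := by
  rw [← Nat.cast_one, residue_add_natCast, h, Nat.mod_self]

theorem residue_mod {m n : ℕ} (h : m ≤ n) (z : ℤ_[p]) : residue n z % p ^ m = residue m z := by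
  have : NeZero p := ⟨(Fact.out : p.Prime).ne_zero⟩
  rw [residue, residue, ← PadicInt.cast_toZModPow m n h z, ZMod.cast_eq_val, ZMod.val_natCast]

theorem residue_eq_residue_iff_toZModPow {n : ℕ} {z w : ℤ_[p]} :
    residue n z = residue n w ↔ PadicInt.toZModPow n z = PadicInt.toZModPow n w :=
  have : NeZero p := ⟨(Fact.out : p.Prime).ne_zero⟩
  (ZMod.val_injective _).eq_iff

theorem residue_eq_residue_iff_norm_sub_le {n : ℕ} {z w : ℤ_[p]} :
    residue n z = residue n w ↔ ‖z - w‖ ≤ (p : ℝ) ^ (-n : ℤ) := by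
  rw [residue_eq_residue_iff_toZModPow, PadicInt.norm_le_pow_iff_mem_span_pow,
    ← PadicInt.ker_toZModPow, RingHom.mem_ker, map_sub, sub_eq_zero]

theorem eq_of_frequently_residue_eq {z w : ℤ_[p]} (h : ∃ᶠ n in atTop, residue n z = residue n w) :
    z = w := by
  refine PadicInt.ext_of_toZModPow.1 fun m => residue_eq_residue_iff_toZModPow.1 ?_
  obtain ⟨n, hmn, hn⟩ := frequently_atTop.1 h m
  rw [← residue_mod hmn, ← residue_mod hmn, hn]

theorem eventually_residue_eq (n : ℕ) (z : ℤ_[p]) : ∀ᶠ w in nhds z, residue n w = residue n z := by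
  have hp : (0 : ℝ) < p := by exact_mod_cast (Fact.out : p.Prime).pos
  filter_upwards [Metric.ball_mem_nhds z (zpow_pos hp (-n : ℤ))] with w hw
  rw [residue_eq_residue_iff_norm_sub_le, ← dist_eq_norm]
  exact (Metric.mem_ball.1 hw).le

theorem measurable_residue (n : ℕ) : Measurable (residue n : ℤ_[p] → ℕ) :=
  ((IsLocallyConstant.iff_eventually_eq _).2 (eventually_residue_eq n)).continuous.measurable

/-- The Haar probability measure on `ℤ_[p]`. -/
def haarProb (p : ℕ) [Fact p.Prime] : Measure ℤ_[p] := Measure.addHaarMeasure ⊤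

instance : IsProbabilityMeasure (haarProb p) := ⟨Measure.addHaarMeasure_self⟩

instance : (haarProb p).IsAddLeftInvariant := Measure.isAddLeftInvariant_addHaarMeasure _

/-- The `p`-adic odometer `z ↦ z + 1`. -/
def odometer (p : ℕ) [Fact p.Prime] : ℤ_[p] ≃ᵐ ℤ_[p] := MeasurableEquiv.addRight 1

theorem measurePreserving_odometer :
    MeasurePreserving (odometer p) (haarProb p) (haarProb p) :=
  measurePreserving_add_right (haarProb p) 1

theorem haarProb_residue_eq_residue_zero {n m : ℕ} (hm : m < p ^ n) :
    (haarProb p).real {z | residue n z = m} = (haarProb p).real {z | residue n z = 0} := by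
  rw [← (measurePreserving_add_right (haarProb p) (m : ℤ_[p])).measureReal_preimage
    (s := {z | residue n z = m})
    (measurable_residue n (measurableSet_singleton m)).nullMeasurableSet]
  congr 1
  ext z
  have residue_eq (w : ℤ_[p]) {k : ℕ} (hk : k < p ^ n) :
      residue n w = k ↔ PadicInt.toZModPow n w = k := by
    rw [← map_natCast (PadicInt.toZModPow n) k, ← residue_eq_residue_iff_toZModPow,
      residue_natCast, Nat.mod_eq_of_lt hk]
  simp only [Set.mem_preimage, Set.mem_ofPred_eq, residue_eq _ hm,
    residue_eq _ (Nat.zero_lt_of_lt hm), map_add, map_natCast, Nat.cast_zero, add_eq_right]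

theorem haarProb_residue_eq {n m : ℕ} (hm : m < p ^ n) :
    (haarProb p).real {z | residue n z = m} = 1 / p ^ n := by
  have hp : (0 : ℝ) < p := by exact_mod_cast (Fact.out : p.Prime).pos
  have iUnion_eq_univ :
      (⋃ k ∈ Finset.range (p ^ n), {z : ℤ_[p] | residue n z = k}) = Set.univ := by
    ext z
    simp [residue_lt]
  have sum_eq := measureReal_biUnion_finset (μ := haarProb p) (s := Finset.range (p ^ n))
    (f := fun k => {z | residue n z = k})
    (fun i _ j _ hij => Set.disjoint_left.2 fun z (hi : residue n z = i) (hj : residue n z = j) =>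
      hij (hi.symm.trans hj))
    (fun k _ => measurable_residue n (measurableSet_singleton k))
  rw [iUnion_eq_univ, probReal_univ, Finset.sum_congr rfl fun k hk =>
    haarProb_residue_eq_residue_zero (Finset.mem_range.1 hk),
    ← haarProb_residue_eq_residue_zero hm, Finset.sum_const, Finset.card_range, nsmul_eq_mul,
    Nat.cast_pow] at sum_eq
  rw [eq_div_iff (by positivity), mul_comm, sum_eq]

theorem haarProb_residue_mem_le (n : ℕ) (s : Finset ℕ) :
    (haarProb p).real {z | residue n z ∈ s} ≤ s.card / p ^ n := by
  have eq_biUnion : {z : ℤ_[p] | residue n z ∈ s} =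
      ⋃ k ∈ s.filter (· < p ^ n), {z | residue n z = k} := by
    ext z
    simp [residue_lt]
  calc (haarProb p).real {z | residue n z ∈ s}
      ≤ ∑ k ∈ s.filter (· < p ^ n), (haarProb p).real {z | residue n z = k} :=
        eq_biUnion ▸ measureReal_biUnion_finset_le _ _
    _ = (s.filter (· < p ^ n)).card / p ^ n := by
        rw [Finset.sum_congr rfl fun k hk => haarProb_residue_eq (Finset.mem_filter.1 hk).2]
        simp [div_eq_mul_inv]
    _ ≤ s.card / p ^ n := by
        gcongr
        exact Finset.filter_subset _ _

end PadicInt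

/-- The data of a cutting and stacking construction over the dyadic odometer: at step `n` the
tower is cut into `2 ^ (E (n + 1) - E n)` columns, and `a n i < L` spacers are put on top of the
`i`-th one. -/
structure SpacerScheme where
  E : ℕ → ℕ
  a : ℕ → ℕ → ℕ
  L : ℕ
  E_zero : E 0 = 0
  E_lt : ∀ n, E n < E (n + 1)
  a_lt : ∀ n i, a n i < L

namespace SpacerScheme

variable (D : SpacerScheme)

theorem strictMono_E : StrictMono D.E := strictMono_nat_of_lt_succ D.E_lt

theorem L_pos : 0 < D.L := Nat.zero_lt_of_lt (D.a_lt 0 0)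

theorem residue_E_zero (z : ℤ_[2]) : residue (D.E 0) z = 0 := by
  have := residue_lt (D.E 0) z
  simp_all only [D.E_zero, pow_zero, Nat.lt_one_iff]

open Classical in
/-- The number of spacers that the orbit of the rank one map visits just before the odometer
point `z`: it is `a n i` if `z ≡ i * 2 ^ E n` modulo `2 ^ E (n + 1)` with `0 < i < 2 ^ (E (n + 1) -
E n)`, and `0` at `z = 0`. -/
def spacer (z : ℤ_[2]) : ℕ :=
  if h : ∃ n, residue (D.E (n + 1)) z ≠ 0 then
    D.a (Nat.find h) (residue (D.E (Nat.find h + 1)) z / 2 ^ D.E (Nat.find h)) else 0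

theorem spacer_lt (z : ℤ_[2]) : D.spacer z < D.L := by
  unfold spacer
  split_ifs
  · exact D.a_lt _ _
  · exact D.L_pos

open Classical in
theorem spacer_of_residue_eq_mul {z : ℤ_[2]} {n i : ℕ}
    (h : residue (D.E (n + 1)) z = i * 2 ^ D.E n) (hi : 0 < i) : D.spacer z = D.a n i := by
  have residue_ne : residue (D.E (n + 1)) z ≠ 0 := by
    rw [h]
    positivity
  have exists_ne : ∃ n, residue (D.E (n + 1)) z ≠ 0 := ⟨n, residue_ne⟩
  have find_eq : Nat.find exists_ne = n := by
    refine (Nat.find_eq_iff _).2 ⟨residue_ne, fun k hk => ?_⟩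
    rw [not_not, ← residue_mod (D.strictMono_E.monotone (by lia : k + 1 ≤ n + 1)), h]
    exact Nat.mod_eq_zero_of_dvd
      (Dvd.dvd.mul_left (pow_dvd_pow 2 (D.strictMono_E.monotone (by lia))) _)
  rw [spacer, dif_pos exists_ne, find_eq, h, Nat.mul_div_cancel _ (by positivity)]

theorem spacer_congr {z w : ℤ_[2]} {n : ℕ} (h : residue (D.E n) z = residue (D.E n) w)
    (h0 : residue (D.E n) z ≠ 0) : D.spacer z = D.spacer w := by
  induction n with
  | zero => exact absurd (D.residue_E_zero z) h0
  | succ n ih =>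
    have hle := D.strictMono_E.monotone (Nat.le_succ n)
    by_cases hn : residue (D.E n) z = 0
    · obtain ⟨i, hi⟩ : 2 ^ D.E n ∣ residue (D.E (n + 1)) z :=
        Nat.dvd_of_mod_eq_zero (by rw [residue_mod hle, hn])
      rw [mul_comm] at hi
      have hi0 : 0 < i := Nat.pos_of_ne_zero fun hi0 => h0 (by rw [hi, hi0, zero_mul])
      rw [D.spacer_of_residue_eq_mul hi hi0, D.spacer_of_residue_eq_mul (h ▸ hi) hi0]
    · exact ih (by rw [← residue_mod hle, h, residue_mod hle]) hn

theorem exists_residue_ne_zero {z : ℤ_[2]} (hz : z ≠ 0) : ∃ n, residue (D.E n) z ≠ 0 := by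
  by_contra! h
  refine hz (eq_of_frequently_residue_eq
    (D.strictMono_E.tendsto_atTop.frequently (Frequently.of_forall fun n => ?_)))
  rw [h, ← Nat.cast_zero (R := ℤ_[2]), residue_natCast, Nat.zero_mod]

theorem measurable_spacer : Measurable D.spacer := by
  refine measurable_of_continuousOn_compl_singleton 0 fun z hz => ContinuousAt.continuousWithinAt ?_
  obtain ⟨n, hn⟩ := D.exists_residue_ne_zero hz
  refine continuousAt_const.congr (f := fun _ => D.spacer z) ?_
  filter_upwards [eventually_residue_eq (D.E n) z] with w hw
  exact D.spacer_congr hw.symm hn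

end SpacerScheme

namespace SpacerScheme

variable (D : SpacerScheme)

theorem measurable_roof : Measurable fun w : ℤ_[2] => D.spacer (w + 1) :=
  D.measurable_spacer.comp (measurable_add_const 1)

/-- The space of the rank one system: the skyscraper with the spacers preceding `w + 1` stacked
over the odometer point `w`. -/
abbrev Space : Type := Skyscraper fun w : ℤ_[2] => D.spacer (w + 1)

/-- The rank one transformation, a Kakutani tower map over the dyadic odometer. -/
def T : D.Space ≃ᵐ D.Space := Skyscraper.measurableShift (odometer 2) D.measurable_roof

/-- The invariant probability measure of the rank one system. -/
def μ : Measure D.Space := Skyscraper.probMeasure (haarProb 2) _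

instance : IsProbabilityMeasure D.μ :=
  Skyscraper.isProbabilityMeasure_probMeasure D.measurable_roof fun _ => D.spacer_lt _

theorem measurePreserving_T : MeasurePreserving D.T D.μ D.μ :=
  Skyscraper.measurePreserving_probMeasure measurePreserving_odometer D.measurable_roof

instance : StandardBorelSpace D.Space :=
  (Skyscraper.measurableSet_skyscraper D.measurable_roof).standardBorel

theorem measureReal_preimage_base_le {A : Set ℤ_[2]} (hA : MeasurableSet A) :
    D.μ.real {x | x.1.1 ∈ A} ≤ D.L * (haarProb 2).real A :=
  Skyscraper.probMeasure_real_preimage_fst_le D.measurable_roof (fun _ => D.spacer_lt _) hA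

theorem T_apply_of_lt {x : D.Space} (h : x.1.2 < D.spacer (x.1.1 + 1)) :
    D.T x = ⟨(x.1.1, x.1.2 + 1), h⟩ :=
  Skyscraper.shift_apply_of_lt (odometer 2).toEquiv h

theorem T_apply_of_eq {x : D.Space} (h : x.1.2 = D.spacer (x.1.1 + 1)) :
    D.T x = ⟨(x.1.1 + 1, 0), Nat.zero_le _⟩ :=
  Skyscraper.shift_apply_of_eq (odometer 2).toEquiv h

/-- The time from the bottom of a tower to its `m`-th level that is not a spacer. -/
def levelTime (m : ℕ) : ℕ := m + ∑ i ∈ Finset.range m, D.spacer ((i + 1 : ℕ) : ℤ_[2])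

theorem levelTime_zero : D.levelTime 0 = 0 := by simp [levelTime]

theorem levelTime_succ (m : ℕ) :
    D.levelTime (m + 1) = D.levelTime m + 1 + D.spacer ((m + 1 : ℕ) : ℤ_[2]) := by
  rw [levelTime, levelTime, Finset.sum_range_succ]
  ring

theorem strictMono_levelTime : StrictMono D.levelTime :=
  strictMono_nat_of_lt_succ fun m => by
    rw [levelTime_succ]
    lia

/-- The height of the `n`-th tower. -/
def towerHeight (n : ℕ) : ℕ := D.levelTime (2 ^ D.E n - 1) + 1

/-- The level of a point in the `n`-th tower; the values from `D.towerHeight n` on are taken on the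
spacers that are put between the `n`-th towers. -/
def offset (n : ℕ) (x : D.Space) : ℕ := D.levelTime (residue (D.E n) x.1.1) + x.1.2

/-- The numbers of spacers that follow the successive visits to the `n`-th tower. -/
def gap (n : ℕ) (x : D.Space) (i : ℕ) : ℕ :=
  D.spacer (x.1.1 - residue (D.E n) x.1.1 + ((i + 1) * 2 ^ D.E n : ℕ))

theorem gap_lt (n : ℕ) (x : D.Space) (i : ℕ) : D.gap n x i < D.L := D.spacer_lt _

theorem two_pow_le_towerHeight (n : ℕ) : 2 ^ D.E n ≤ D.towerHeight n := by
  have := D.strictMono_levelTime.le_apply (x := 2 ^ D.E n - 1)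
  rw [towerHeight]
  lia

theorem levelTime_lt_towerHeight {n m : ℕ} (h : m < 2 ^ D.E n) :
    D.levelTime m < D.towerHeight n :=
  Nat.lt_succ_of_le (D.strictMono_levelTime.monotone (by lia))

theorem residue_lt_or_eq (n : ℕ) (w : ℤ_[2]) :
    residue (D.E n) w + 1 < 2 ^ D.E n ∨ residue (D.E n) w + 1 = 2 ^ D.E n :=
  (Nat.succ_le_of_lt (residue_lt _ w)).lt_or_eq

theorem spacer_add_one {n : ℕ} {w : ℤ_[2]} (h : residue (D.E n) w + 1 < 2 ^ D.E n) :
    D.spacer (w + 1) = D.spacer ((residue (D.E n) w + 1 : ℕ) : ℤ_[2]) := by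
  have residue_eq := residue_add_one_of_lt h
  refine D.spacer_congr (n := n) ?_ (by lia)
  rw [residue_eq, residue_natCast, Nat.mod_eq_of_lt h]

theorem offset_lt_levelTime {n : ℕ} {x : D.Space} (h : residue (D.E n) x.1.1 + 1 < 2 ^ D.E n) :
    D.offset n x < D.levelTime (residue (D.E n) x.1.1 + 1) := by
  have floor_le : x.1.2 ≤ D.spacer (x.1.1 + 1) := x.2
  rw [D.spacer_add_one h] at floor_le
  rw [levelTime_succ, offset]
  lia

theorem offset_add_one_lt_of_lt {n : ℕ} {x : D.Space}
    (h : residue (D.E n) x.1.1 + 1 < 2 ^ D.E n) : D.offset n x + 1 < D.towerHeight n :=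
  (Nat.succ_le_of_lt (D.offset_lt_levelTime h)).trans_lt (D.levelTime_lt_towerHeight h)

theorem offset_add_one_of_eq {n : ℕ} {x : D.Space} (h : residue (D.E n) x.1.1 + 1 = 2 ^ D.E n) :
    D.offset n x + 1 = D.towerHeight n + x.1.2 := by
  rw [offset, towerHeight, ← h, Nat.add_sub_cancel, add_right_comm]

theorem residue_add_one_eq_of_towerHeight_le {n : ℕ} {x : D.Space}
    (h : D.towerHeight n ≤ D.offset n x) : residue (D.E n) x.1.1 + 1 = 2 ^ D.E n :=
  (D.residue_lt_or_eq n x.1.1).resolve_left fun hlt => by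
    have := D.offset_add_one_lt_of_lt hlt
    lia

theorem gap_zero_of_eq {n : ℕ} {x : D.Space} (h : residue (D.E n) x.1.1 + 1 = 2 ^ D.E n) :
    D.gap n x 0 = D.spacer (x.1.1 + 1) := by
  rw [gap, ← h]
  congr 1
  push_cast
  ring

theorem gap_congr {n i j : ℕ} {x y : D.Space}
    (h : x.1.1 - residue (D.E n) x.1.1 + (i : ℤ_[2]) * 2 ^ D.E n =
      y.1.1 - residue (D.E n) y.1.1 + (j : ℤ_[2]) * 2 ^ D.E n) :
    D.gap n x i = D.gap n y j := by
  rw [gap, gap]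
  congr 1
  push_cast
  linear_combination h

theorem offset_gap_T_of_floor_lt (n : ℕ) {x : D.Space} (hx : x.1.2 < D.spacer (x.1.1 + 1)) :
    D.offset n (D.T x) = D.offset n x + 1 ∧ D.gap n (D.T x) = D.gap n x := by
  rw [D.T_apply_of_lt hx]
  exact ⟨(add_assoc _ _ _).symm, rfl⟩

theorem offset_gap_T_of_residue_lt {n : ℕ} {x : D.Space} (hx : x.1.2 = D.spacer (x.1.1 + 1))
    (h : residue (D.E n) x.1.1 + 1 < 2 ^ D.E n) :
    D.offset n (D.T x) = D.offset n x + 1 ∧ D.gap n (D.T x) = D.gap n x := by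
  have residue_eq := residue_add_one_of_lt h
  rw [D.T_apply_of_eq hx]
  constructor
  · rw [offset, offset, residue_eq, levelTime_succ, hx, D.spacer_add_one h]
    ring
  · funext i
    refine D.gap_congr ?_
    simp only [residue_eq]
    push_cast
    ring

theorem offset_gap_T_of_residue_eq {n : ℕ} {x : D.Space} (hx : x.1.2 = D.spacer (x.1.1 + 1))
    (h : residue (D.E n) x.1.1 + 1 = 2 ^ D.E n) :
    D.offset n (D.T x) = 0 ∧ D.gap n (D.T x) = fun i => D.gap n x (i + 1) := by
  have residue_eq := residue_add_one_of_eq h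
  have two_pow_eq : (2 : ℤ_[2]) ^ D.E n = residue (D.E n) x.1.1 + 1 := by exact_mod_cast h.symm
  rw [D.T_apply_of_eq hx]
  constructor
  · simp only [offset, residue_eq, levelTime_zero]
  · funext i
    refine D.gap_congr ?_
    simp only [residue_eq, two_pow_eq]
    push_cast
    ring

theorem blockCoding (n : ℕ) :
    BlockCoding D.T (D.towerHeight n) D.L (D.offset n) (D.gap n) where
  gap_lt := D.gap_lt n
  offset_lt x := by
    have floor_le : x.1.2 ≤ D.spacer (x.1.1 + 1) := x.2
    rcases D.residue_lt_or_eq n x.1.1 with h | h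
    · have := D.offset_add_one_lt_of_lt h
      lia
    · have := D.offset_add_one_of_eq h
      rw [D.gap_zero_of_eq h]
      lia
  step x hx := by
    have floor_le : x.1.2 ≤ D.spacer (x.1.1 + 1) := x.2
    rcases floor_le.lt_or_eq with hlt | heq
    · exact D.offset_gap_T_of_floor_lt n hlt
    · rcases D.residue_lt_or_eq n x.1.1 with h | h
      · exact D.offset_gap_T_of_residue_lt heq h
      · rw [D.offset_add_one_of_eq h, D.gap_zero_of_eq h, heq] at hx
        exact absurd hx (lt_irrefl _)
  wrap x hx := by
    rcases D.residue_lt_or_eq n x.1.1 with h | h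
    · have := D.offset_add_one_lt_of_lt h
      lia
    · rw [D.offset_add_one_of_eq h, D.gap_zero_of_eq h] at hx
      exact D.offset_gap_T_of_residue_eq (Nat.add_left_cancel hx) h

theorem offset_lt_towerHeight_add (n : ℕ) (x : D.Space) :
    D.offset n x < D.towerHeight n + D.L :=
  ((D.blockCoding n).offset_lt x).trans (Nat.add_lt_add_left (D.gap_lt n x 0) _)

theorem residue_le_of_offset_le {n : ℕ} {x y : D.Space} (h : D.offset n y ≤ D.offset n x) :
    residue (D.E n) y.1.1 ≤ residue (D.E n) x.1.1 := by
  by_contra! hlt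
  have offset_lt := D.offset_lt_levelTime (n := n) (x := x)
    ((Nat.succ_le_of_lt hlt).trans_lt (residue_lt _ _))
  have levelTime_le : D.levelTime (residue (D.E n) x.1.1 + 1) ≤ D.offset n y :=
    (D.strictMono_levelTime.monotone (Nat.succ_le_of_lt hlt)).trans (Nat.le_add_right _ _)
  lia

theorem offset_eq_offset_iff {n : ℕ} {x y : D.Space} :
    D.offset n x = D.offset n y ↔
      residue (D.E n) x.1.1 = residue (D.E n) y.1.1 ∧ x.1.2 = y.1.2 := by
  constructor
  · intro h
    have residue_eq :=
      le_antisymm (D.residue_le_of_offset_le h.le) (D.residue_le_of_offset_le h.ge)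
    refine ⟨residue_eq, ?_⟩
    rw [offset, offset, residue_eq] at h
    exact Nat.add_left_cancel h
  · rintro ⟨residue_eq, floor_eq⟩
    rw [offset, offset, residue_eq, floor_eq]

theorem offset_congr {r n : ℕ} (hrn : r ≤ n) {x y : D.Space} (h : D.offset n x = D.offset n y) :
    D.offset r x = D.offset r y := by
  obtain ⟨residue_eq, floor_eq⟩ := D.offset_eq_offset_iff.1 h
  have hE := D.strictMono_E.monotone hrn
  exact D.offset_eq_offset_iff.2
    ⟨by rw [← residue_mod hE, ← residue_mod hE, residue_eq], floor_eq⟩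

theorem offset_le_offset {r n : ℕ} (hrn : r ≤ n) (x : D.Space) : D.offset r x ≤ D.offset n x := by
  rw [offset, offset, ← residue_mod (D.strictMono_E.monotone hrn)]
  gcongr
  exact D.strictMono_levelTime.monotone (Nat.mod_le _ _)

theorem residue_add_one_eq_of_le {r n : ℕ} (hrn : r ≤ n) {w : ℤ_[2]}
    (h : residue (D.E n) w + 1 = 2 ^ D.E n) : residue (D.E r) w + 1 = 2 ^ D.E r := by
  have hE := D.strictMono_E.monotone hrn
  refine (D.residue_lt_or_eq r w).resolve_left fun hlt => ?_
  have residue_eq := residue_add_one_of_lt hlt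
  rw [← residue_mod hE, residue_add_one_of_eq h, Nat.zero_mod] at residue_eq
  exact Nat.succ_ne_zero _ residue_eq.symm

theorem offsetFactor {r n : ℕ} (hrn : r ≤ n) :
    OffsetFactor (D.towerHeight n) (D.towerHeight r) (D.offset n) (D.offset r) := by
  refine BlockCoding.offsetFactor D.T.surjective (D.blockCoding n) (D.blockCoding r)
    (D.offset_le_offset hrn) (fun x y h => D.offset_congr hrn h) fun x hx => ?_
  have h := D.residue_add_one_eq_of_towerHeight_le hx
  have := D.offset_add_one_of_eq h
  have := D.offset_add_one_of_eq (D.residue_add_one_eq_of_le hrn h)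
  lia

theorem measurable_base : Measurable fun x : D.Space => x.1.1 :=
  measurable_fst.comp measurable_subtype_coe

theorem measurable_residue_base (n : ℕ) : Measurable fun x : D.Space => residue (D.E n) x.1.1 :=
  (measurable_residue _).comp D.measurable_base

theorem measurable_offset (n : ℕ) : Measurable (D.offset n) :=
  ((measurable_from_top (f := D.levelTime)).comp (D.measurable_residue_base n)).add
    (measurable_snd.comp measurable_subtype_coe)

theorem measurable_gap (n i : ℕ) : Measurable fun x => D.gap n x i :=
  D.measurable_spacer.comp ((D.measurable_base.sub
    ((measurable_from_top (f := fun m : ℕ => (m : ℤ_[2]))).comp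
      (D.measurable_residue_base n))).add_const _)

theorem tendsto_const_div_two_pow_E (c : ℝ) :
    Tendsto (fun n => c / 2 ^ D.E n) atTop (nhds 0) :=
  tendsto_const_nhds.div_atTop
    ((tendsto_pow_atTop_atTop_of_one_lt one_lt_two).comp D.strictMono_E.tendsto_atTop)

/-- The points within `D.L` levels of the bottom of the `n`-th tower, or on the spacers above it. -/
def IsNearEnd (n : ℕ) (x : D.Space) : Prop := D.offset n x < D.L ∨ D.towerHeight n ≤ D.offset n x

theorem measureReal_isNearEnd_le (n : ℕ) :
    D.μ.real {x | D.IsNearEnd n x} ≤ D.L * (D.L + 1) / 2 ^ D.E n := by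
  let s := insert (2 ^ D.E n - 1) (Finset.range D.L)
  have subset_residue :
      {x | D.IsNearEnd n x} ⊆ {x | x.1.1 ∈ {w | residue (D.E n) w ∈ s}} := by
    rintro x (h | h) <;> change residue (D.E n) x.1.1 ∈ s
    · exact Finset.mem_insert_of_mem (Finset.mem_range.2 (lt_of_le_of_lt
        (D.strictMono_levelTime.le_apply.trans (Nat.le_add_right _ _)) h))
    · exact Finset.mem_insert.2
        (Or.inl (Nat.eq_sub_of_add_eq (D.residue_add_one_eq_of_towerHeight_le h)))
  calc D.μ.real {x | D.IsNearEnd n x}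
      ≤ D.L * (haarProb 2).real {w | residue (D.E n) w ∈ s} :=
        (measureReal_mono subset_residue).trans
          (D.measureReal_preimage_base_le (measurable_residue _ (Finset.measurableSet s)))
    _ ≤ D.L * (s.card / 2 ^ D.E n) := by
        gcongr
        exact_mod_cast haarProb_residue_mem_le (p := 2) (D.E n) s
    _ ≤ D.L * ((D.L + 1) / 2 ^ D.E n) := by
        have card_le := Finset.card_insert_le (2 ^ D.E n - 1) (Finset.range D.L)
        rw [Finset.card_range] at card_le
        gcongr
        exact_mod_cast card_le
    _ = D.L * (D.L + 1) / 2 ^ D.E n := mul_div_assoc _ _ _ |>.symm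

theorem tendsto_measureReal_isNearEnd :
    Tendsto (fun n => D.μ.real {x | D.IsNearEnd n x}) atTop (nhds 0) :=
  squeeze_zero (fun _ => measureReal_nonneg) D.measureReal_isNearEnd_le
    (D.tendsto_const_div_two_pow_E _)

instance : NullSingletonClass D.μ := by
  refine ⟨fun x => ?_⟩
  have singleton_le (n : ℕ) : D.μ.real {x} ≤ D.L / 2 ^ D.E n := by
    have subset_residue :
        ({x} : Set D.Space) ⊆ {y | y.1.1 ∈ {w | residue (D.E n) w = residue (D.E n) x.1.1}} := by
      rintro y rfl
      rfl
    refine (measureReal_mono subset_residue).trans ((D.measureReal_preimage_base_le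
      (A := {w | residue (D.E n) w = residue (D.E n) x.1.1})
      (measurable_residue _ (measurableSet_singleton _))).trans_eq ?_)
    rw [haarProb_residue_eq (residue_lt _ _), mul_one_div, Nat.cast_ofNat]
  refine (measureReal_eq_zero_iff).1 (le_antisymm ?_ measureReal_nonneg)
  exact ge_of_tendsto' (D.tendsto_const_div_two_pow_E _) singleton_le

theorem injective_offset : Function.Injective fun (x : D.Space) n => D.offset n x := by
  intro x y h
  have offset_eq (n : ℕ) := D.offset_eq_offset_iff.1 (congrFun h n)
  refine Subtype.ext (Prod.ext (eq_of_frequently_residue_eq ?_) (offset_eq 0).2)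
  exact D.strictMono_E.tendsto_atTop.frequently
    (Frequently.of_forall fun n => (offset_eq n).1)

theorem exists_preimage_offset_eq {r n : ℕ} (hrn : r ≤ n) (S : Set ℕ) :
    ∃ S', D.offset n ⁻¹' S' = D.offset r ⁻¹' S := by
  refine ⟨D.offset n '' (D.offset r ⁻¹' S), Set.Subset.antisymm ?_ (Set.subset_preimage_image _ _)⟩
  rintro x ⟨y, hy, hxy⟩
  rwa [Set.mem_preimage, ← D.offset_congr hrn hxy]

theorem measurableSpace_eq_generateFrom_preimage_offset :
    (inferInstance : MeasurableSpace D.Space) =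
      MeasurableSpace.generateFrom {A | ∃ r S, A = D.offset r ⁻¹' S} := by
  have measurable_pi : Measurable fun (x : D.Space) (n : ℕ) => D.offset n x :=
    measurable_pi_lambda _ D.measurable_offset
  refine le_antisymm ?_ (MeasurableSpace.generateFrom_le ?_)
  · rw [← (measurable_pi.measurableEmbedding D.injective_offset).comap_eq, MeasurableSpace.pi,
      MeasurableSpace.comap_iSup]
    refine iSup_le fun n => ?_
    rw [MeasurableSpace.comap_comp]
    rintro A ⟨S, -, rfl⟩
    exact MeasurableSpace.measurableSet_generateFrom ⟨n, S, rfl⟩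
  · rintro A ⟨r, S, rfl⟩
    exact D.measurable_offset r (MeasurableSet.of_discrete)

theorem exists_measure_symmDiff_preimage_offset_lt {B : Set D.Space} (hB : MeasurableSet B)
    {ε : ℝ} (hε : 0 < ε) :
    ∃ r S, D.μ (symmDiff B (D.offset r ⁻¹' S)) < ENNReal.ofReal ε := by
  have isSetAlgebra : IsSetAlgebra {A | ∃ r S, A = D.offset r ⁻¹' S} := by
    refine ⟨⟨0, ∅, by simp⟩, ?_, ?_⟩
    · rintro A ⟨r, S, rfl⟩
      exact ⟨r, Sᶜ, rfl⟩
    · rintro A B ⟨r, S, rfl⟩ ⟨k, S', rfl⟩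
      obtain ⟨U, hU⟩ := D.exists_preimage_offset_eq (le_max_left r k) S
      obtain ⟨V, hV⟩ := D.exists_preimage_offset_eq (le_max_right r k) S'
      exact ⟨max r k, U ∪ V, by rw [Set.preimage_union, hU, hV]⟩
  obtain ⟨A, ⟨r, S, rfl⟩, h⟩ :=
    (Measure.MeasureDense.of_generateFrom_isSetAlgebra_finite (μ := D.μ) isSetAlgebra
      D.measurableSpace_eq_generateFrom_preimage_offset).approx B hB (measure_ne_top _ _) ε hε
  exact ⟨r, S, h⟩

end SpacerScheme

theorem residue_add_natCast_eq_iff {p : ℕ} [Fact p.Prime] {n m k : ℕ} (h : m + k < p ^ n)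
    (z : ℤ_[p]) : residue n (z + (k : ℤ_[p])) = m + k ↔ residue n z = m := by
  rw [residue_add_natCast, ← Nat.mod_eq_of_lt h]
  refine ⟨fun h' => ?_, fun h' => by rw [h']⟩
  exact (Nat.ModEq.add_right_cancel' k h').eq_of_lt_of_lt (residue_lt n z) (by lia)

theorem measurableSet_image_iterate {X : Type*} [MeasurableSpace X] (T : X ≃ᵐ X) (k : ℕ)
    {A : Set X} (hA : MeasurableSet A) : MeasurableSet (T^[k] '' A) := by
  induction k with
  | zero => simpa using hA
  | succ k ih =>
    rw [Function.iterate_succ', Set.image_comp]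
    exact T.measurableEmbedding.measurableSet_image.2 ih

namespace SpacerScheme

variable (D : SpacerScheme)

/-- The number of columns into which the `n`-th tower is cut. -/
def q (n : ℕ) : ℕ := 2 ^ (D.E (n + 1) - D.E n)

theorem two_pow_E_succ (n : ℕ) : 2 ^ D.E (n + 1) = D.q n * 2 ^ D.E n := by
  rw [q, ← pow_add, Nat.sub_add_cancel (D.E_lt n).le]

theorem two_le_q (n : ℕ) : 2 ≤ D.q n :=
  Nat.le_self_pow (Nat.sub_ne_zero_of_lt (D.E_lt n)) 2

theorem spacer_natCast_mul {n i : ℕ} (hi : 0 < i) (hiq : i < D.q n) :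
    D.spacer ((i * 2 ^ D.E n : ℕ) : ℤ_[2]) = D.a n i := by
  refine D.spacer_of_residue_eq_mul ?_ hi
  rw [residue_natCast, Nat.mod_eq_of_lt]
  rw [two_pow_E_succ]
  exact Nat.mul_lt_mul_of_pos_right hiq (by positivity)

theorem levelTime_mul_add {n b m : ℕ} (hm : m < 2 ^ D.E n) :
    D.levelTime (b * 2 ^ D.E n + m) = D.levelTime (b * 2 ^ D.E n) + D.levelTime m := by
  induction m with
  | zero => rw [levelTime_zero, add_zero, add_zero]
  | succ m ih =>
    have mod_eq : (b * 2 ^ D.E n + m + 1) % 2 ^ D.E n = m + 1 := by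
      rw [add_assoc, Nat.add_comm, Nat.add_mul_mod_self_right, Nat.mod_eq_of_lt hm]
    have spacer_eq :
        D.spacer ((b * 2 ^ D.E n + m + 1 : ℕ) : ℤ_[2]) = D.spacer ((m + 1 : ℕ) : ℤ_[2]) := by
      refine D.spacer_congr (n := n) ?_ ?_
      · rw [residue_natCast, residue_natCast, mod_eq, Nat.mod_eq_of_lt hm]
      · rw [residue_natCast, mod_eq]
        exact Nat.succ_ne_zero m
    rw [← add_assoc, levelTime_succ, levelTime_succ, ih (by lia), spacer_eq]
    ring

theorem levelTime_mul {n b : ℕ} (hb : b < D.q n) :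
    D.levelTime (b * 2 ^ D.E n) = b * D.towerHeight n + ∑ i ∈ Finset.Ico 1 (b + 1), D.a n i := by
  induction b with
  | zero => simp [levelTime_zero]
  | succ b ih =>
    have two_pow_pos : 0 < 2 ^ D.E n := by positivity
    have mul_eq : (b + 1) * 2 ^ D.E n = b * 2 ^ D.E n + (2 ^ D.E n - 1) + 1 := by
      rw [add_mul]
      lia
    have spacer_eq := D.spacer_natCast_mul b.succ_pos hb
    rw [Nat.succ_eq_add_one, mul_eq] at spacer_eq
    rw [mul_eq, levelTime_succ, spacer_eq, D.levelTime_mul_add (by lia), ih (by lia),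
      Finset.sum_Ico_succ_top (Nat.le_add_left 1 b), towerHeight]
    ring

theorem towerHeight_zero : D.towerHeight 0 = 1 := by
  rw [towerHeight, D.E_zero, pow_zero, Nat.sub_self, levelTime_zero]

theorem towerHeight_succ (n : ℕ) :
    D.towerHeight (n + 1) = D.q n * D.towerHeight n + spacerCount D.q D.a n := by
  have two_pow_pos : 0 < 2 ^ D.E n := by positivity
  obtain ⟨b, hb⟩ : ∃ b, D.q n = b + 1 := Nat.exists_eq_add_of_le' (one_le_two.trans (D.two_le_q n))
  have top_eq : 2 ^ D.E (n + 1) - 1 = b * 2 ^ D.E n + (2 ^ D.E n - 1) := by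
    rw [two_pow_E_succ, hb, add_mul]
    lia
  rw [towerHeight, top_eq, D.levelTime_mul_add (by lia), D.levelTime_mul (by lia), spacerCount, hb,
    add_assoc _ _ 1, ← towerHeight]
  ring

theorem height_eq (n : ℕ) : height D.q D.a n = D.towerHeight n := by
  induction n with
  | zero => rw [height, towerHeight_zero]
  | succ n ih => rw [height, ih, towerHeight_succ]

theorem spacerCount_le (n : ℕ) : spacerCount D.q D.a n ≤ D.q n * D.L :=
  calc spacerCount D.q D.a n ≤ ∑ _i ∈ Finset.Ico 1 (D.q n), D.L :=
        Finset.sum_le_sum fun i _ => (D.a_lt n i).le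
    _ = (D.q n - 1) * D.L := by rw [Finset.sum_const, Nat.card_Ico, smul_eq_mul]
    _ ≤ D.q n * D.L := Nat.mul_le_mul_right _ (Nat.sub_le _ _)

theorem q_mul_two_pow_le_height_succ (n : ℕ) : D.q n * 2 ^ n ≤ height D.q D.a (n + 1) := by
  rw [height, height_eq]
  refine (Nat.mul_le_mul_left _ ?_).trans (Nat.le_add_right _ _)
  exact (Nat.pow_le_pow_right two_pos D.strictMono_E.le_apply).trans (D.two_pow_le_towerHeight n)

theorem summable_spacers :
    Summable fun n => (spacerCount D.q D.a n : ℝ) / (height D.q D.a (n + 1) : ℝ) := by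
  refine Summable.of_nonneg_of_le (fun n => by positivity) (fun n => ?_)
    (summable_geometric_two.mul_left (D.L : ℝ))
  have q_pos : (0 : ℝ) < D.q n := by exact_mod_cast two_pos.trans_le (D.two_le_q n)
  have count_le : (spacerCount D.q D.a n : ℝ) ≤ D.q n * D.L := by exact_mod_cast D.spacerCount_le n
  have le_height : (D.q n * 2 ^ n : ℝ) ≤ height D.q D.a (n + 1) := by
    exact_mod_cast D.q_mul_two_pow_le_height_succ n
  calc (spacerCount D.q D.a n : ℝ) / (height D.q D.a (n + 1) : ℝ)
      ≤ D.q n * D.L / (D.q n * 2 ^ n) := by gcongr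
    _ = D.L * (1 / 2) ^ n := by
        rw [mul_div_mul_left _ _ q_pos.ne', one_div, inv_pow, div_eq_mul_inv]

/-- The point of the skyscraper on the ground floor over `w`. -/
def ground (w : ℤ_[2]) : D.Space := ⟨(w, 0), Nat.zero_le _⟩

theorem injective_ground : Function.Injective D.ground := fun _ _ h =>
  congrArg (fun x : D.Space => x.1.1) h

theorem iterate_ground {w : ℤ_[2]} {j : ℕ} (hj : j ≤ D.spacer (w + 1)) :
    D.T^[j] (D.ground w) = ⟨(w, j), hj⟩ := by
  induction j with
  | zero => rfl
  | succ j ih =>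
    rw [Function.iterate_succ_apply', ih (by lia)]
    exact D.T_apply_of_lt (x := ⟨(w, j), (Nat.le_succ j).trans hj⟩) hj

theorem iterate_spacer_add_one_ground (w : ℤ_[2]) :
    D.T^[D.spacer (w + 1) + 1] (D.ground w) = D.ground (w + 1) := by
  rw [Function.iterate_succ_apply', D.iterate_ground le_rfl]
  exact D.T_apply_of_eq (x := ⟨(w, _), le_rfl⟩) rfl

theorem iterate_levelTime_ground {n m : ℕ} {w : ℤ_[2]} (hw : residue (D.E n) w = 0)
    (hm : m < 2 ^ D.E n) : D.T^[D.levelTime m] (D.ground w) = D.ground (w + m) := by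
  induction m with
  | zero => simp [levelTime_zero]
  | succ m ih =>
    have residue_eq : residue (D.E n) (w + (m : ℤ_[2])) = m := by
      rw [residue_add_natCast, hw, zero_add, Nat.mod_eq_of_lt (by lia)]
    have levelTime_eq : D.levelTime (m + 1) = (D.spacer (w + m + 1) + 1) + D.levelTime m := by
      rw [levelTime_succ, D.spacer_add_one (n := n) (by lia), residue_eq]
      ring
    rw [levelTime_eq, Function.iterate_add_apply, ih (by lia), iterate_spacer_add_one_ground,
      Nat.cast_succ, add_assoc]

theorem iterate_towerHeight_ground {n : ℕ} {w : ℤ_[2]} (hw : residue (D.E n) w = 0) :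
    D.T^[D.towerHeight n + D.spacer (w + (2 ^ D.E n : ℕ))] (D.ground w) =
      D.ground (w + (2 ^ D.E n : ℕ)) := by
  have two_pow_pos : 0 < 2 ^ D.E n := by positivity
  have top_add_one : w + ((2 ^ D.E n - 1 : ℕ) : ℤ_[2]) + 1 = w + (2 ^ D.E n : ℕ) := by
    rw [add_assoc, ← Nat.cast_succ, Nat.succ_eq_add_one, Nat.sub_add_cancel two_pow_pos]
  have time_eq : D.towerHeight n + D.spacer (w + (2 ^ D.E n : ℕ)) =
      (D.spacer (w + ((2 ^ D.E n - 1 : ℕ) : ℤ_[2]) + 1) + 1) + D.levelTime (2 ^ D.E n - 1) := by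
    rw [top_add_one, towerHeight]
    ring
  rw [time_eq, Function.iterate_add_apply, D.iterate_levelTime_ground hw (by lia),
    iterate_spacer_add_one_ground, top_add_one]

/-- The base of the `n`-th tower. -/
def base (n : ℕ) : Set D.Space := D.ground '' {w | residue (D.E n) w = 0}

theorem base_eq (n : ℕ) : D.base n = {x | D.offset n x = 0} := by
  ext ⟨⟨w, j⟩, hj⟩
  have residue_le := D.strictMono_levelTime.le_apply (x := residue (D.E n) w)
  constructor
  · rintro ⟨v, hv : residue (D.E n) v = 0, hx⟩
    rw [← hx]
    simp only [Set.mem_ofPred_eq, offset, ground, hv, levelTime_zero]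
  · intro h
    obtain ⟨levelTime_eq, rfl⟩ : D.levelTime (residue (D.E n) w) = 0 ∧ j = 0 :=
      Nat.add_eq_zero_iff.1 h
    exact ⟨w, Nat.eq_zero_of_le_zero (levelTime_eq ▸ residue_le), rfl⟩

theorem measurableSet_base (n : ℕ) : MeasurableSet (D.base n) := by
  rw [base_eq]
  exact D.measurable_offset n (measurableSet_singleton 0)

theorem image_iterate_base {n k : ℕ} (hk : k < D.towerHeight n) :
    D.T^[k] '' D.base n = {x | D.offset n x = k} := by
  induction k with
  | zero => rw [base_eq, Function.iterate_zero, Set.image_id]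
  | succ k ih =>
    rw [Function.iterate_succ', Set.image_comp, ih (by lia)]
    ext y
    obtain ⟨x, rfl⟩ := D.T.surjective y
    rw [D.T.injective.mem_set_image, Set.mem_ofPred_eq, Set.mem_ofPred_eq]
    constructor
    · intro hx
      rw [((D.blockCoding n).step x (by lia)).1, hx]
    · intro hTx
      rcases (D.blockCoding n).step_or_wrap x with ⟨-, offset_eq, -⟩ | ⟨-, offset_eq, -⟩ <;> lia

/-- The base of the `i`-th column of the `n`-th tower, for `1 ≤ i ≤ D.q n`. -/
def columnBase (n i : ℕ) : Set D.Space :=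
  D.ground '' {w | residue (D.E (n + 1)) w = (i - 1) * 2 ^ D.E n}

theorem measurableSet_columnBase (n i : ℕ) : MeasurableSet (D.columnBase n i) := by
  have : D.columnBase n i = {x | residue (D.E (n + 1)) x.1.1 = (i - 1) * 2 ^ D.E n} ∩
      {x | x.1.2 = 0} := by
    ext x
    constructor
    · rintro ⟨w, hw, rfl⟩
      exact ⟨hw, rfl⟩
    · rintro ⟨hw, hfloor⟩
      exact ⟨x.1.1, hw, Subtype.ext (Prod.ext rfl hfloor.symm)⟩
  rw [this]
  exact (((measurable_residue _).comp (measurable_fst.comp measurable_subtype_coe))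
    (measurableSet_singleton _)).inter
    ((measurable_snd.comp measurable_subtype_coe) (measurableSet_singleton 0))

theorem columnBase_one (n : ℕ) : D.columnBase n 1 = D.base (n + 1) := by
  rw [columnBase, Nat.sub_self, zero_mul, base]

theorem disjoint_columnBase {n i j : ℕ} (hi : 1 ≤ i) (hj : 1 ≤ j) (hij : i ≠ j) :
    Disjoint (D.columnBase n i) (D.columnBase n j) := by
  refine (Set.disjoint_image_iff D.injective_ground).2 (Set.disjoint_left.2 fun w hwi hwj => ?_)
  have := Nat.eq_of_mul_eq_mul_right (by positivity) (hwi.symm.trans hwj)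
  lia

theorem base_eq_iUnion_columnBase (n : ℕ) :
    D.base n = ⋃ i ∈ Finset.Icc 1 (D.q n), D.columnBase n i := by
  simp only [columnBase, ← Set.image_iUnion₂]
  rw [base]
  congr 1
  ext w
  simp only [Set.mem_ofPred_eq, Set.mem_iUnion, Finset.mem_Icc, exists_prop]
  rw [← residue_mod (D.E_lt n).le]
  constructor
  · intro hw
    obtain ⟨k, hk⟩ := Nat.dvd_of_mod_eq_zero hw
    have mul_lt := residue_lt (D.E (n + 1)) w
    rw [hk, two_pow_E_succ, mul_comm] at mul_lt
    exact ⟨k + 1, ⟨k.succ_pos, lt_of_mul_lt_mul_right mul_lt (Nat.zero_le _)⟩,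
      by rw [hk, Nat.add_sub_cancel, mul_comm]⟩
  · rintro ⟨i, -, hw⟩
    rw [hw, Nat.mul_mod_left]

theorem image_iterate_columnBase {n i : ℕ} (hi : 1 ≤ i) (hiq : i < D.q n) :
    D.T^[D.towerHeight n + D.a n i] '' D.columnBase n i = D.columnBase n (i + 1) := by
  obtain ⟨b, rfl⟩ := Nat.exists_eq_add_of_le' hi
  have add_lt : b * 2 ^ D.E n + 2 ^ D.E n < 2 ^ D.E (n + 1) := by
    rw [two_pow_E_succ, ← Nat.succ_mul]
    exact Nat.mul_lt_mul_of_pos_right hiq (by positivity)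
  have iterate_eq (w : ℤ_[2]) (hw : residue (D.E (n + 1)) w = b * 2 ^ D.E n) :
      D.T^[D.towerHeight n + D.a n (b + 1)] (D.ground w) =
        D.ground (w + ((2 ^ D.E n : ℕ) : ℤ_[2])) := by
    rw [← D.spacer_of_residue_eq_mul (z := w + ((2 ^ D.E n : ℕ) : ℤ_[2])) _ hi]
    · exact D.iterate_towerHeight_ground (by rw [← residue_mod (D.E_lt n).le, hw, Nat.mul_mod_left])
    · rw [Nat.succ_mul]
      exact (residue_add_natCast_eq_iff add_lt w).2 hw
  have image_congr_iterate := Set.image_congr (s := {w | residue (D.E (n + 1)) w = b * 2 ^ D.E n})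
    iterate_eq
  rw [columnBase, columnBase, Nat.add_sub_cancel, Nat.add_sub_cancel, Set.image_image,
    image_congr_iterate, ← Set.image_image D.ground, Set.image_add_right]
  congr 1
  ext w
  rw [Set.mem_preimage, Set.mem_ofPred_eq, Set.mem_ofPred_eq,
    ← residue_add_natCast_eq_iff add_lt, neg_add_cancel_right, Nat.succ_mul]

theorem sUnion_image_iterate_base (n : ℕ) (S : Set ℕ) :
    ⋃₀ {A | ∃ k < D.towerHeight n, k ∈ S ∧ A = D.T^[k] '' D.base n} =
      D.offset n ⁻¹' S \ {x | D.towerHeight n ≤ D.offset n x} := by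
  ext x
  simp only [Set.mem_sUnion, Set.mem_ofPred_eq, Set.mem_sdiff, Set.mem_preimage, not_le]
  constructor
  · rintro ⟨A, ⟨k, hk, hkS, rfl⟩, hx⟩
    rw [D.image_iterate_base hk] at hx
    obtain rfl : D.offset n x = k := hx
    exact ⟨hkS, hk⟩
  · rintro ⟨hS, hlt⟩
    refine ⟨_, ⟨_, hlt, hS, rfl⟩, ?_⟩
    rw [D.image_iterate_base hlt]
    rfl

theorem tendsto_measure_towerHeight_le_offset :
    Tendsto (fun n => D.μ {x | D.towerHeight n ≤ D.offset n x}) atTop (nhds 0) := by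
  have tendsto_ofReal := ENNReal.tendsto_ofReal D.tendsto_measureReal_isNearEnd
  rw [ENNReal.ofReal_zero] at tendsto_ofReal
  refine tendsto_of_tendsto_of_tendsto_of_le_of_le tendsto_const_nhds tendsto_ofReal
    (fun _ => zero_le) fun n => ?_
  rw [ofReal_measureReal]
  exact measure_mono fun _ hx => Or.inr hx

theorem approachesPoints :
    ApproachesPoints D.μ fun n => towerPartition D.T (D.base n) (D.towerHeight n) := by
  intro B hB ε hε
  obtain ⟨e, -, e_lt⟩ := ENNReal.lt_iff_exists_real_btwn.1 (ENNReal.half_pos hε.ne')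
  rw [ENNReal.ofReal_pos] at e_lt
  obtain ⟨r, S, hS⟩ := D.exists_measure_symmDiff_preimage_offset_lt hB e_lt.1
  obtain ⟨N, hN⟩ := eventually_atTop.1
    (D.tendsto_measure_towerHeight_le_offset.eventually_lt_const (ENNReal.half_pos hε.ne'))
  refine ⟨max r N, fun n hn => ?_⟩
  obtain ⟨S', hS'⟩ := D.exists_preimage_offset_eq (le_of_max_le_left hn) S
  refine ⟨{A | ∃ k < D.towerHeight n, k ∈ S' ∧ A = D.T^[k] '' D.base n}, ?_, ?_⟩
  · rintro A ⟨k, hk, -, rfl⟩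
    exact Or.inl ⟨k, hk, rfl⟩
  have symmDiff_subset : symmDiff B (D.offset r ⁻¹' S \ {x | D.towerHeight n ≤ D.offset n x}) ⊆
      symmDiff B (D.offset r ⁻¹' S) ∪ {x | D.towerHeight n ≤ D.offset n x} := by
    intro x hx
    simp only [Set.mem_symmDiff, Set.mem_sdiff, Set.mem_union] at hx ⊢
    tauto
  rw [sUnion_image_iterate_base, hS']
  calc D.μ (symmDiff B (D.offset r ⁻¹' S \ {x | D.towerHeight n ≤ D.offset n x}))
      ≤ D.μ (symmDiff B (D.offset r ⁻¹' S)) + D.μ {x | D.towerHeight n ≤ D.offset n x} :=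
        (measure_mono symmDiff_subset).trans (measure_union_le _ _)
    _ < ε / 2 + ε / 2 :=
        ENNReal.add_lt_add (hS.trans e_lt.2) (hN n (le_of_max_le_right hn))
    _ = ε := ENNReal.add_halves ε

theorem isCutAndStack : IsCutAndStack D.μ D.T D.q D.a D.base D.columnBase
    (fun n i j => D.T^[D.towerHeight n + (j - 1)] '' D.columnBase n i) where
  two_le_q := D.two_le_q
  summable_spacers := D.summable_spacers
  measurable_F := D.measurableSet_base
  measurable_Fs n i _ _ := D.measurableSet_columnBase n i
  measurable_C n i _ _ _ _ _ := measurableSet_image_iterate _ _ (D.measurableSet_columnBase n i)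
  levels_disjoint n k l hk hl hkl := by
    rw [height_eq] at hk hl
    rw [D.image_iterate_base hk, D.image_iterate_base hl, Set.disjoint_left]
    exact fun x hxk hxl => hkl (hxk.symm.trans hxl)
  columns_disjoint _ _ _ hi _ hj _ hij := D.disjoint_columnBase hi hj hij
  columns_cover := D.base_eq_iUnion_columnBase
  top_to_spacer n i _ _ _ := by rw [height_eq, Nat.sub_self, add_zero]
  top_to_next n i hi hiq h0 := by
    rw [← D.image_iterate_columnBase hi hiq, h0, add_zero, height_eq]
  spacer_to_spacer n i j _ _ hj _ := by
    rw [← Set.image_comp, ← Function.iterate_succ', Nat.add_sub_cancel, Nat.succ_eq_add_one,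
      add_assoc, Nat.sub_add_cancel hj]
  spacer_to_next n i hi hiq h0 := by
    rw [← Set.image_comp, ← Function.iterate_succ', ← D.image_iterate_columnBase hi hiq,
      Nat.succ_eq_add_one, add_assoc, Nat.sub_add_cancel h0]
  next_base n := (D.columnBase_one n).symm
  generating := by
    simp only [height_eq]
    exact D.approachesPoints

theorem isRankOneSystem : IsRankOneSystem D.μ D.T where
  standardBorel := inferInstance
  isProbabilityMeasure := inferInstance
  nullSingleton := inferInstance
  measurePreserving := D.measurePreserving_T
  cutAndStack := ⟨_, _, _, _, _, D.isCutAndStack⟩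

end SpacerScheme

section Names

variable {X ι : Type*} [MeasurableSpace X] {μ : Measure X}

theorem measurable_fin_mk {k : ℕ} {f : X → ℕ} (hf : Measurable f) (h : ∀ x, f x < k) :
    Measurable fun x => (⟨f x, h x⟩ : Fin k) := by
  refine measurable_to_countable' fun v => ?_
  simp only [Set.preimage, Set.mem_singleton_iff, Fin.ext_iff]
  exact hf (measurableSet_singleton v.1)

theorem measurable_seqCoding [MeasurableSpace ι] {T : X → X} (hT : Measurable T) (t : ℕ → ℕ)
    {φ : X → ι} (hφ : Measurable φ) (N : ℕ) : Measurable (seqCoding T t φ N) :=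
  measurable_pi_lambda _ fun _ => hφ.comp (hT.iterate _)

variable [Fintype ι] [MeasurableSpace ι] [MeasurableSingletonClass ι]

theorem shannonEntropy_seqCoding_le [IsProbabilityMeasure μ] {T : X → X}
    (hT : MeasurePreserving T μ μ) (t : ℕ → ℕ) {φ : X → ι} (hφ : Measurable φ) (N : ℕ) :
    shannonEntropy μ (seqCoding T t φ N) ≤ N * shannonEntropy μ φ :=
  calc shannonEntropy μ (seqCoding T t φ N)
      ≤ ∑ k : Fin N, shannonEntropy μ (fun x => φ (T^[t (k + 1)] x)) :=
        shannonEntropy_pi_le (measurable_seqCoding hT.measurable t hφ N)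
    _ = ∑ _k : Fin N, shannonEntropy μ φ :=
        Finset.sum_congr rfl fun k _ =>
          shannonEntropy_comp_measurePreserving (hT.iterate _) hφ
    _ = N * shannonEntropy μ φ := by
        rw [Finset.sum_const, Finset.card_univ, Fintype.card_fin, nsmul_eq_mul]

theorem exists_forall_shannonEntropy_seqCoding_le [Nonempty ι] {ε : ℝ} (hε : 0 < ε) :
    ∃ δ > 0, ∀ {X : Type*} [MeasurableSpace X] (μ : Measure X) [IsProbabilityMeasure μ]
      {T : X → X}, MeasurePreserving T μ μ → ∀ {φ ψ : X → ι}, Measurable φ → Measurable ψ →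
      μ.real {x | φ x ≠ ψ x} < δ → ∀ (t : ℕ → ℕ) (N : ℕ),
      shannonEntropy μ (seqCoding T t φ N) ≤ shannonEntropy μ (seqCoding T t ψ N) + N * ε := by
  classical
  obtain ⟨i₀⟩ := ‹Nonempty ι›
  obtain ⟨δ, hδ, entropy_lt⟩ := exists_forall_shannonEntropy_lt (i₀, i₀) hε
  refine ⟨δ, hδ, fun {X} _ μ _ {T} hT {φ ψ} hφ hψ hφψ t N => ?_⟩
  let diff : X → ι × ι := fun x => if φ x = ψ x then (i₀, i₀) else (φ x, ψ x)
  have measurable_diff : Measurable diff :=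
    Measurable.ite (measurableSet_eq_fun hφ hψ) measurable_const (hφ.prodMk hψ)
  have entropy_diff_lt : shannonEntropy μ diff < ε := by
    refine entropy_lt μ measurable_diff ((measureReal_mono fun x hx => ?_).trans_lt hφψ)
    exact fun heq => hx (if_pos heq)
  have factorsThrough : (seqCoding T t φ N).FactorsThrough
      fun x => (seqCoding T t ψ N x, seqCoding T t diff N x) := by
    intro x y hxy
    obtain ⟨hψxy, hdiff⟩ := Prod.mk.inj hxy
    funext k
    have hψk : ψ (T^[t (k + 1)] x) = ψ (T^[t (k + 1)] y) := congrFun hψxy k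
    have hdiffk : diff (T^[t (k + 1)] x) = diff (T^[t (k + 1)] y) := congrFun hdiff k
    change φ (T^[t (k + 1)] x) = φ (T^[t (k + 1)] y)
    grind
  have measurable_ψ := measurable_seqCoding hT.measurable t hψ N
  have measurable_diffs := measurable_seqCoding hT.measurable t measurable_diff N
  calc shannonEntropy μ (seqCoding T t φ N)
      ≤ shannonEntropy μ fun x => (seqCoding T t ψ N x, seqCoding T t diff N x) :=
        shannonEntropy_le_of_factorsThrough (measurable_ψ.prodMk measurable_diffs) factorsThrough
    _ ≤ shannonEntropy μ (seqCoding T t ψ N) + shannonEntropy μ (seqCoding T t diff N) :=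
        shannonEntropy_prodMk_le measurable_ψ measurable_diffs
    _ ≤ shannonEntropy μ (seqCoding T t ψ N) + N * ε := by
        gcongr
        refine (shannonEntropy_seqCoding_le hT t measurable_diff N).trans ?_
        gcongr

end Names

namespace SpacerScheme

variable (D : SpacerScheme)

/-- The level in the `n`-th tower as an element of a finite type. -/
def offsetFin (n : ℕ) (x : D.Space) : Fin (D.towerHeight n + D.L) :=
  ⟨D.offset n x, D.offset_lt_towerHeight_add n x⟩

/-- The numbers of spacers that follow the next `W` visits to the `n`-th tower. -/
def window (n W : ℕ) (x : D.Space) (i : Fin W) : Fin D.L := ⟨D.gap n x i, D.gap_lt n x i⟩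

theorem measurable_offsetFin (n : ℕ) : Measurable (D.offsetFin n) :=
  measurable_fin_mk (D.measurable_offset n) _

theorem measurable_window (n W : ℕ) : Measurable (D.window n W) :=
  measurable_pi_lambda _ fun i => measurable_fin_mk (D.measurable_gap n i) _

theorem seqCoding_offset_factorsThrough {ι : Type*} (g : ℕ → ι) {r n : ℕ} (hrn : r ≤ n)
    {t : ℕ → ℕ} (ht : Monotone t) {N W : ℕ}
    (hW : D.towerHeight n + D.L + t N ≤ W * D.towerHeight n) :
    (seqCoding D.T t (fun x => g (D.offset r x)) N).FactorsThrough
      fun x => (D.offsetFin n x, D.window n W x) := by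
  intro x y hxy
  obtain ⟨hoffset, hwindow⟩ := Prod.mk.inj hxy
  funext k
  exact congrArg g <| D.offset_congr hrn <|
    (D.blockCoding n).offset_iterate_eq (congrArg Fin.val hoffset)
      (fun l hl => congrArg Fin.val (congrFun hwindow ⟨l, hl⟩))
      ((Nat.add_le_add_left (ht k.2) _).trans hW)

theorem shannonEntropy_seqCoding_offset_le {ι : Type*} [Fintype ι] (g : ℕ → ι) {r n : ℕ}
    (hrn : r ≤ n) {t : ℕ → ℕ} (ht : Monotone t) {N W : ℕ}
    (hW : D.towerHeight n + D.L + t N ≤ W * D.towerHeight n) :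
    shannonEntropy D.μ (seqCoding D.T t (fun x => g (D.offset r x)) N) ≤
      Real.log (D.towerHeight n + D.L) + W * Real.log D.L := by
  have measurable_pair := (D.measurable_offsetFin n).prodMk (D.measurable_window n W)
  have hL : (0 : ℝ) < D.L := by exact_mod_cast D.L_pos
  calc shannonEntropy D.μ (seqCoding D.T t (fun x => g (D.offset r x)) N)
      ≤ shannonEntropy D.μ fun x => (D.offsetFin n x, D.window n W x) :=
        shannonEntropy_le_of_factorsThrough measurable_pair
          (D.seqCoding_offset_factorsThrough g hrn ht hW)
    _ ≤ Real.log (((D.towerHeight n + D.L) * D.L ^ W : ℕ) : ℝ) := by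
        simpa using shannonEntropy_le_log_card measurable_pair
    _ = Real.log (D.towerHeight n + D.L) + W * Real.log D.L := by
        push_cast
        rw [Real.log_mul (by positivity) (by positivity), Real.log_pow]

theorem exists_measureReal_ne_comp_offset_lt {ι : Type*} [Finite ι] [Nonempty ι]
    [MeasurableSpace ι] [MeasurableSingletonClass ι] {φ : D.Space → ι} (hφ : Measurable φ)
    {δ : ℝ} (hδ : 0 < δ) :
    ∃ (r : ℕ) (g : ℕ → ι), D.μ.real {x | φ x ≠ g (D.offset r x)} < δ := by
  classical
  have := Fintype.ofFinite ι
  obtain ⟨i₀⟩ := ‹Nonempty ι›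
  have error_pos : 0 < δ / Fintype.card ι := div_pos hδ (by exact_mod_cast Fintype.card_pos)
  choose r S hS using fun i => D.exists_measure_symmDiff_preimage_offset_lt
    (hφ (measurableSet_singleton i)) error_pos
  choose U hU using fun i =>
    D.exists_preimage_offset_eq (Finset.le_sup (Finset.mem_univ i) : r i ≤ Finset.univ.sup r) (S i)
  refine ⟨Finset.univ.sup r, fun v => if h : ∃ i, v ∈ U i then h.choose else i₀, ?_⟩
  have subset_iUnion : {x | φ x ≠
      if h : ∃ i, D.offset (Finset.univ.sup r) x ∈ U i then h.choose else i₀} ⊆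
      ⋃ i ∈ (Finset.univ : Finset ι), symmDiff (φ ⁻¹' {i}) (D.offset (r i) ⁻¹' S i) := by
    intro x hx
    by_contra hnot
    simp only [Finset.mem_univ, Set.iUnion_true, Set.mem_iUnion, not_exists] at hnot
    have mem_iff (i : ι) : D.offset (Finset.univ.sup r) x ∈ U i ↔ φ x = i := by
      have hnoti := hnot i
      rw [← hU i] at hnoti
      simp only [Set.mem_symmDiff, Set.mem_preimage, Set.mem_singleton_iff] at hnoti
      tauto
    have hex : ∃ i, D.offset (Finset.univ.sup r) x ∈ U i := ⟨φ x, (mem_iff _).2 rfl⟩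
    refine hx ?_
    rw [dif_pos hex]
    exact (mem_iff _).1 hex.choose_spec
  calc D.μ.real _
      ≤ ∑ i, D.μ.real (symmDiff (φ ⁻¹' {i}) (D.offset (r i) ⁻¹' S i)) :=
        (measureReal_mono subset_iUnion (measure_ne_top _ _)).trans
          (measureReal_biUnion_finset_le _ _)
    _ < ∑ _i : ι, δ / Fintype.card ι :=
        Finset.sum_lt_sum_of_nonempty Finset.univ_nonempty fun i _ =>
          (ENNReal.lt_ofReal_iff_toReal_lt (measure_ne_top _ _)).1 (hS i)
    _ = δ := by
        rw [Finset.sum_const, Finset.card_univ, nsmul_eq_mul,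
          mul_div_cancel₀ _ (by exact_mod_cast Fintype.card_ne_zero)]

theorem exists_shannonEntropy_seqCoding_le {ι : Type*} [Fintype ι] [MeasurableSpace ι]
    [MeasurableSingletonClass ι] {φ : D.Space → ι} (hφ : Measurable φ) (t : ℕ → ℕ) {ε : ℝ}
    (hε : 0 < ε) :
    ∃ (r : ℕ) (g : ℕ → ι), ∀ N, shannonEntropy D.μ (seqCoding D.T t φ N) ≤
      shannonEntropy D.μ (seqCoding D.T t (fun x => g (D.offset r x)) N) + N * ε := by
  have : Nonempty ι := ⟨φ (D.ground 0)⟩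
  obtain ⟨δ, hδ, entropy_le⟩ := exists_forall_shannonEntropy_seqCoding_le (ι := ι) hε
  obtain ⟨r, g, hg⟩ := D.exists_measureReal_ne_comp_offset_lt hφ hδ
  exact ⟨r, g, entropy_le D.μ D.measurePreserving_T hφ
    ((Measurable.of_discrete (f := g)).comp (D.measurable_offset r)) hg t⟩

end SpacerScheme

section WordSeq

theorem card_wordSeq_window_mul_pow_le {L K Q : ℕ} (hK : 0 < K) (hQ : K * L ^ K ≤ Q) (v : ℕ → ℕ) :
    ((Finset.range Q).filter fun b =>
      b + K < Q → ∀ i < K, wordSeq L K (b + 1 + i) = v i).card * L ^ K ≤ 3 * Q := by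
  let inner := (Finset.range (Q - K)).filter fun b => ∀ i < K, wordSeq L K (b + 1 + i) = v i
  have card_inner_le : inner.card ≤ K * (Q / (K * L ^ K) + 1) := by
    rw [← Finset.card_map (addRightEmbedding 1)]
    refine card_le_of_wordSeq_window_eq hK v _ ?_ ?_ <;> intro c hc <;>
      obtain ⟨b, hb, rfl⟩ := Finset.mem_map.1 hc <;>
      obtain ⟨hbQ, hb⟩ := Finset.mem_filter.1 hb
    · have := Finset.mem_range.1 hbQ
      simp only [addRightEmbedding_apply]
      lia
    · exact hb
  have subset_union : ((Finset.range Q).filter fun b =>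
      b + K < Q → ∀ i < K, wordSeq L K (b + 1 + i) = v i) ⊆ inner ∪ Finset.Ico (Q - K) Q := by
    intro b hb
    simp only [inner, Finset.mem_union, Finset.mem_filter, Finset.mem_range, Finset.mem_Ico] at hb ⊢
    grind
  calc _ ≤ (K * (Q / (K * L ^ K) + 1) + K) * L ^ K := by
        refine Nat.mul_le_mul_right _ ((Finset.card_le_card subset_union).trans
          ((Finset.card_union_le _ _).trans (add_le_add card_inner_le ?_)))
        rw [Nat.card_Ico]
        lia
    _ = Q / (K * L ^ K) * (K * L ^ K) + 2 * (K * L ^ K) := by ring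
    _ ≤ Q + 2 * Q := add_le_add (Nat.div_mul_le_self _ _) (Nat.mul_le_mul_left _ hQ)
    _ = 3 * Q := by ring

end WordSeq

namespace SpacerScheme

variable (D : SpacerScheme)

open Classical in
/-- The number of spacers above the `n`-th tower that is current at time `t k`, recorded only if
the observation at time `t (k + 1)` is near the end of an `r`-th tower, and `0` otherwise. -/
def edgeGap (r n : ℕ) (t : ℕ → ℕ) (k : ℕ) (x : D.Space) : Fin D.L :=
  if D.IsNearEnd r (D.T^[t (k + 1)] x) then ⟨D.gap n (D.T^[t k] x) 0, D.gap_lt n _ 0⟩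
  else ⟨0, D.L_pos⟩

theorem measurableSet_isNearEnd (n : ℕ) : MeasurableSet {x | D.IsNearEnd n x} :=
  D.measurable_offset n (MeasurableSet.of_discrete (s := {m | m < D.L ∨ D.towerHeight n ≤ m}))

theorem measurable_edgeGap (r n : ℕ) (t : ℕ → ℕ) (k : ℕ) : Measurable (D.edgeGap r n t k) := by
  classical
  have measurable_gap := measurable_fin_mk (D.measurable_gap n 0) fun x => D.gap_lt n x 0
  exact Measurable.ite (D.T.measurable.iterate _ (D.measurableSet_isNearEnd r))
    (measurable_gap.comp (D.T.measurable.iterate _)) measurable_const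

theorem exists_forall_shannonEntropy_edgeGap_lt {ε : ℝ} (hε : 0 < ε) (t : ℕ → ℕ) :
    ∃ r, ∀ n k, shannonEntropy D.μ (D.edgeGap r n t k) < ε := by
  obtain ⟨δ, hδ, entropy_lt⟩ := exists_forall_shannonEntropy_lt (⟨0, D.L_pos⟩ : Fin D.L) hε
  obtain ⟨r, hr⟩ := (D.tendsto_measureReal_isNearEnd.eventually_lt_const hδ).exists
  refine ⟨r, fun n k => entropy_lt D.μ (D.measurable_edgeGap r n t k) (lt_of_le_of_lt ?_ hr)⟩
  rw [← (D.measurePreserving_T.iterate (t (k + 1))).measureReal_preimage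
    (D.measurableSet_isNearEnd r).nullMeasurableSet]
  exact measureReal_mono fun x hx => not_not.1 fun hnot => hx (if_neg hnot)

theorem window_factorsThrough {r n : ℕ} (hrn : r ≤ n) {t : ℕ → ℕ} (ht0 : t 0 = 0)
    (ht : Monotone t) {N M : ℕ} (hstep : ∀ k < N, t (k + 1) ≤ t k + D.towerHeight n)
    (hM : M * (D.towerHeight n + D.L) ≤ t N) :
    (D.window n M).FactorsThrough fun x => ((seqCoding D.T t (D.offsetFin r) N x,
      D.offsetFin n x), fun k : Fin N => D.edgeGap r n t k x) := by
  intro x y hxy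
  simp only [Prod.mk.injEq] at hxy
  obtain ⟨⟨hobs, hoffset⟩, hedge⟩ := hxy
  have offset_eq : ∀ k < N, D.offset r (D.T^[t (k + 1)] x) = D.offset r (D.T^[t (k + 1)] y) :=
    fun k hk => congrArg Fin.val (congrFun hobs ⟨k, hk⟩)
  have gap_eq : ∀ k < N, D.IsNearEnd r (D.T^[t (k + 1)] x) →
      D.gap n (D.T^[t k] x) 0 = D.gap n (D.T^[t k] y) 0 := by
    intro k hk hx
    have hy : D.IsNearEnd r (D.T^[t (k + 1)] y) := by rwa [IsNearEnd, ← offset_eq k hk]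
    have := congrFun hedge ⟨k, hk⟩
    simp only [edgeGap, if_pos hx, if_pos hy] at this
    exact congrArg Fin.val this
  obtain ⟨i, hi, -, gaps_eq⟩ := (D.blockCoding n).exists_common_crosses (D.offsetFactor hrn) ht0 ht
    N hstep (congrArg Fin.val hoffset) offset_eq gap_eq
  have hMi : M < i + 1 :=
    lt_of_mul_lt_mul_right (hM.trans_lt (hi.lt_mul (D.blockCoding n))) (Nat.zero_le _)
  exact funext fun l => Fin.ext (gaps_eq l (l.2.trans_le (Nat.lt_succ_iff.1 hMi)))

theorem shannonEntropy_window_le {r n : ℕ} (hrn : r ≤ n) {t : ℕ → ℕ} (ht0 : t 0 = 0)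
    (ht : Monotone t) {N M : ℕ} (hstep : ∀ k < N, t (k + 1) ≤ t k + D.towerHeight n)
    (hM : M * (D.towerHeight n + D.L) ≤ t N) {ε : ℝ}
    (hε : ∀ k, shannonEntropy D.μ (D.edgeGap r n t k) ≤ ε) :
    shannonEntropy D.μ (D.window n M) ≤
      shannonEntropy D.μ (seqCoding D.T t (D.offsetFin r) N) +
        Real.log (D.towerHeight n + D.L) + N * ε := by
  have measurable_names := measurable_seqCoding D.T.measurable t (D.measurable_offsetFin r) N
  have measurable_edges : Measurable fun x (k : Fin N) => D.edgeGap r n t k x :=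
    measurable_pi_lambda _ fun k => D.measurable_edgeGap r n t k
  have measurable_pair := measurable_names.prodMk (D.measurable_offsetFin n)
  have entropy_offset_le : shannonEntropy D.μ (D.offsetFin n) ≤
      Real.log (D.towerHeight n + D.L) := by
    simpa using shannonEntropy_le_log_card (D.measurable_offsetFin n)
  have entropy_edges_le : shannonEntropy D.μ (fun x (k : Fin N) => D.edgeGap r n t k x) ≤ N * ε :=
    calc _ ≤ ∑ k : Fin N, shannonEntropy D.μ (D.edgeGap r n t k) :=
          shannonEntropy_pi_le measurable_edges
      _ ≤ ∑ _k : Fin N, ε := Finset.sum_le_sum fun k _ => hε k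
      _ = N * ε := by simp
  calc shannonEntropy D.μ (D.window n M) ≤ _ :=
        shannonEntropy_le_of_factorsThrough (measurable_pair.prodMk measurable_edges)
          (D.window_factorsThrough hrn ht0 ht hstep hM)
    _ ≤ _ := shannonEntropy_prodMk_le measurable_pair measurable_edges
    _ ≤ _ := add_le_add ((shannonEntropy_prodMk_le measurable_names
        (D.measurable_offsetFin n)).trans (by gcongr)) entropy_edges_le

theorem shannonEntropy_window_add_le (n M R : ℕ) :
    shannonEntropy D.μ (D.window n (M + R)) ≤
      shannonEntropy D.μ (D.window n M) + R * Real.log D.L := by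
  let tail (x : D.Space) (i : Fin R) : Fin D.L := D.window n (M + R) x (Fin.natAdd M i)
  have measurable_tail : Measurable tail :=
    measurable_pi_lambda _ fun i =>
      (measurable_pi_apply (Fin.natAdd M i)).comp (D.measurable_window n (M + R))
  have factorsThrough : (D.window n (M + R)).FactorsThrough
      fun x => (D.window n M x, tail x) := by
    intro x y hxy
    obtain ⟨hwindow, htail⟩ := Prod.mk.inj hxy
    exact funext fun l => Fin.addCases (congrFun hwindow) (congrFun htail) l
  calc shannonEntropy D.μ (D.window n (M + R)) ≤ _ :=
        shannonEntropy_le_of_factorsThrough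
          ((D.measurable_window n M).prodMk measurable_tail) factorsThrough
    _ ≤ shannonEntropy D.μ (D.window n M) + shannonEntropy D.μ tail :=
        shannonEntropy_prodMk_le (D.measurable_window n M) measurable_tail
    _ ≤ shannonEntropy D.μ (D.window n M) + R * Real.log D.L := by
        gcongr
        simpa using shannonEntropy_le_log_card measurable_tail

/-- The index of the column of the `(n + 1)`-st tower, cut into `D.q n` columns over the base of the
`n`-th one, that contains the odometer point `w`. -/
def columnIndex (n : ℕ) (w : ℤ_[2]) : ℕ := residue (D.E (n + 1)) w / 2 ^ D.E n

theorem columnIndex_lt (n : ℕ) (w : ℤ_[2]) : D.columnIndex n w < D.q n := by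
  rw [columnIndex, Nat.div_lt_iff_lt_mul (by positivity), ← two_pow_E_succ]
  exact residue_lt _ _

theorem gap_eq_a {n i : ℕ} {x : D.Space} (h : D.columnIndex n x.1.1 + 1 + i < D.q n) :
    D.gap n x i = D.a n (D.columnIndex n x.1.1 + 1 + i) := by
  have hE := (D.E_lt n).le
  refine D.spacer_of_residue_eq_mul ?_ (by lia)
  have residue_base : residue (D.E (n + 1)) (x.1.1 - (residue (D.E n) x.1.1 : ℤ_[2])) =
      D.columnIndex n x.1.1 * 2 ^ D.E n := by
    have decomp : D.columnIndex n x.1.1 * 2 ^ D.E n + residue (D.E n) x.1.1 =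
        residue (D.E (n + 1)) x.1.1 := by
      rw [columnIndex, ← residue_mod hE, Nat.div_add_mod']
    rw [← residue_add_natCast_eq_iff (decomp ▸ residue_lt _ _), sub_add_cancel, decomp]
  have mul_lt : (D.columnIndex n x.1.1 + 1 + i) * 2 ^ D.E n < 2 ^ D.E (n + 1) := by
    rw [two_pow_E_succ]
    exact Nat.mul_lt_mul_of_pos_right h (by positivity)
  have split : (D.columnIndex n x.1.1 + 1 + i) * 2 ^ D.E n =
      D.columnIndex n x.1.1 * 2 ^ D.E n + (i + 1) * 2 ^ D.E n := by ring
  rw [split] at mul_lt ⊢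
  exact (residue_add_natCast_eq_iff mul_lt _).2 residue_base

theorem haarProb_columnIndex_mem_le (n : ℕ) (s : Finset ℕ) :
    (haarProb 2).real {w | D.columnIndex n w ∈ s} ≤ s.card / D.q n := by
  classical
  let residues := (s ×ˢ Finset.range (2 ^ D.E n)).image fun p => p.1 * 2 ^ D.E n + p.2
  have subset_residues :
      {w | D.columnIndex n w ∈ s} ⊆ {w | residue (D.E (n + 1)) w ∈ residues} := fun w hw =>
    Finset.mem_image.2 ⟨(D.columnIndex n w, residue (D.E (n + 1)) w % 2 ^ D.E n),
      Finset.mem_product.2 ⟨hw, Finset.mem_range.2 (Nat.mod_lt _ (by positivity))⟩,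
      Nat.div_add_mod' _ _⟩
  have card_le : residues.card ≤ s.card * 2 ^ D.E n := by
    refine Finset.card_image_le.trans ?_
    rw [Finset.card_product, Finset.card_range]
  have two_pow_eq : (2 : ℝ) ^ D.E (n + 1) = D.q n * 2 ^ D.E n := by
    exact_mod_cast D.two_pow_E_succ n
  calc (haarProb 2).real {w | D.columnIndex n w ∈ s}
      ≤ residues.card / 2 ^ D.E (n + 1) :=
        (measureReal_mono subset_residues).trans
          (by exact_mod_cast haarProb_residue_mem_le (p := 2) (D.E (n + 1)) residues)
    _ ≤ s.card * 2 ^ D.E n / (D.q n * 2 ^ D.E n) := by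
        rw [two_pow_eq]
        gcongr
        exact_mod_cast card_le
    _ = s.card / D.q n := mul_div_mul_right _ _ (by positivity)

variable {D}

theorem measureReal_window_le {n K : ℕ} (hK : 0 < K) (ha : ∀ i, D.a n i = wordSeq D.L K i)
    (hq : K * D.L ^ K ≤ D.q n) (v : Fin K → Fin D.L) :
    D.μ.real (D.window n K ⁻¹' {v}) ≤ D.L * (3 / D.L ^ K) := by
  let word (i : ℕ) : ℕ := if h : i < K then v ⟨i, h⟩ else 0
  let s := (Finset.range (D.q n)).filter fun b =>
    b + K < D.q n → ∀ i < K, wordSeq D.L K (b + 1 + i) = word i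
  have subset_columns :
      D.window n K ⁻¹' {v} ⊆ {x | x.1.1 ∈ {w | D.columnIndex n w ∈ s}} := by
    intro x hx
    refine Finset.mem_filter.2 ⟨Finset.mem_range.2 (D.columnIndex_lt n _), fun hlt i hi => ?_⟩
    have hxi : D.gap n x i = v ⟨i, hi⟩ := congrArg Fin.val (congrFun hx ⟨i, hi⟩)
    rw [← ha, ← D.gap_eq_a (by lia), hxi]
    simp only [word, dif_pos hi]
  have measurableSet_columns : MeasurableSet {w | D.columnIndex n w ∈ s} :=
    ((measurable_from_top (f := fun m : ℕ => m / 2 ^ D.E n)).comp (measurable_residue _))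
      (Finset.measurableSet s)
  have L_pos : (0 : ℝ) < D.L := by exact_mod_cast D.L_pos
  have q_pos : (0 : ℝ) < D.q n := by exact_mod_cast zero_lt_two.trans_le (D.two_le_q n)
  calc D.μ.real (D.window n K ⁻¹' {v})
      ≤ D.L * (haarProb 2).real {w | D.columnIndex n w ∈ s} :=
        (measureReal_mono subset_columns).trans
          (D.measureReal_preimage_base_le measurableSet_columns)
    _ ≤ D.L * (s.card / D.q n) := by
        gcongr
        exact D.haarProb_columnIndex_mem_le n s
    _ ≤ D.L * (3 / D.L ^ K) := by
        refine mul_le_mul_of_nonneg_left ?_ L_pos.le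
        rw [div_le_div_iff₀ q_pos (by positivity)]
        exact_mod_cast card_wordSeq_window_mul_pow_le hK hq word

theorem le_shannonEntropy_window {n K : ℕ} (hK : 0 < K) (ha : ∀ i, D.a n i = wordSeq D.L K i)
    (hq : K * D.L ^ K ≤ D.q n) :
    K * Real.log D.L - Real.log (3 * D.L) ≤ shannonEntropy D.μ (D.window n K) := by
  have hL : (0 : ℝ) < D.L := by exact_mod_cast D.L_pos
  calc K * Real.log D.L - Real.log (3 * D.L) = -Real.log (D.L * (3 / D.L ^ K)) := by
        rw [← mul_div_assoc, Real.log_div (by positivity) (by positivity), Real.log_pow, mul_comm 3]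
        ring
    _ ≤ shannonEntropy D.μ (D.window n K) :=
        neg_log_le_shannonEntropy (D.measurable_window n K) (measureReal_window_le hK ha hq)

theorem le_shannonEntropy_seqCoding_offsetFin {r n : ℕ} (hrn : r ≤ n) {t : ℕ → ℕ} (ht0 : t 0 = 0)
    (ht : Monotone t) {N M K : ℕ} (hstep : ∀ k < N, t (k + 1) ≤ t k + D.towerHeight n)
    (hM : M * (D.towerHeight n + D.L) ≤ t N) {ε : ℝ}
    (hε : ∀ k, shannonEntropy D.μ (D.edgeGap r n t k) ≤ ε) (hK : 0 < K) (hMK : M ≤ K)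
    (ha : ∀ i, D.a n i = wordSeq D.L K i) (hq : K * D.L ^ K ≤ D.q n) :
    M * Real.log D.L - Real.log (3 * D.L) - Real.log (D.towerHeight n + D.L) - N * ε ≤
      shannonEntropy D.μ (seqCoding D.T t (D.offsetFin r) N) := by
  have le_window := le_shannonEntropy_window hK ha hq
  have window_le := D.shannonEntropy_window_le hrn ht0 ht hstep hM hε
  have tail_le := D.shannonEntropy_window_add_le n M (K - M)
  rw [Nat.add_sub_cancel' hMK, Nat.cast_sub hMK] at tail_le
  linarith

end SpacerScheme

namespace SpacerScheme

/-- The spacers at a tower of height `h` are placed according to the words of length `κ h`, and up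
to a factor `2` the tower is cut into as many columns as these words have digits in total. -/
structure HasWordLengths (D : SpacerScheme) (κ : ℕ → ℕ) : Prop where
  a_eq : ∀ n i, D.a n i = wordSeq D.L (κ (D.towerHeight n)) i
  le_q : ∀ n, κ (D.towerHeight n) * D.L ^ κ (D.towerHeight n) ≤ D.q n
  q_le : ∀ n, D.q n ≤ 2 * (κ (D.towerHeight n) * D.L ^ κ (D.towerHeight n))

theorem towerHeight_pos (D : SpacerScheme) (n : ℕ) : 0 < D.towerHeight n := Nat.succ_pos _

end SpacerScheme

/-- The pair of the exponent `E n` and the height of the `n`-th tower of the spacer scheme with word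
lengths `κ`, which determine each other recursively. -/
def towerParams (L : ℕ) (κ : ℕ → ℕ) : ℕ → ℕ × ℕ
  | 0 => (0, 1)
  | n + 1 =>
    let p := towerParams L κ n
    let e := Nat.clog 2 (κ p.2 * L ^ κ p.2)
    (p.1 + e, 2 ^ e * p.2 + ∑ i ∈ Finset.Ico 1 (2 ^ e), wordSeq L (κ p.2) i)

theorem towerParams_snd_pos (L : ℕ) (κ : ℕ → ℕ) (n : ℕ) : 0 < (towerParams L κ n).2 := by
  induction n with
  | zero => exact one_pos
  | succ n ih => exact Nat.add_pos_left (Nat.mul_pos (by positivity) ih) _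

theorem two_pow_clog_le_two_mul {m : ℕ} (hm : 2 ≤ m) : 2 ^ Nat.clog 2 m ≤ 2 * m := by
  have pow_pred_lt := Nat.pow_pred_clog_lt_self one_lt_two hm
  obtain ⟨k, hk⟩ := Nat.exists_eq_succ_of_ne_zero (Nat.clog_pos one_lt_two hm).ne'
  rw [hk, Nat.pred_succ] at pow_pred_lt
  rw [hk, pow_succ]
  lia

theorem exists_hasWordLengths {L : ℕ} (hL : 2 ≤ L) {κ : ℕ → ℕ} (hκ : ∀ h, 0 < h → 0 < κ h) :
    ∃ D : SpacerScheme, D.L = L ∧ D.HasWordLengths κ := by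
  let height (n : ℕ) : ℕ := (towerParams L κ n).2
  let digits (n : ℕ) : ℕ := κ (height n) * L ^ κ (height n)
  have two_le_digits (n : ℕ) : 2 ≤ digits n := by
    have κ_pos := hκ (height n) (towerParams_snd_pos L κ n)
    calc 2 ≤ L := hL
      _ ≤ L ^ κ (height n) := Nat.le_self_pow κ_pos.ne' L
      _ ≤ digits n := Nat.le_mul_of_pos_left _ κ_pos
  let D : SpacerScheme :=
    { E := fun n => (towerParams L κ n).1
      a := fun n i => wordSeq L (κ (height n)) i
      L := L
      E_zero := rfl
      E_lt := fun n => Nat.lt_add_of_pos_right (Nat.clog_pos one_lt_two (two_le_digits n))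
      a_lt := fun n i => Nat.mod_lt _ (by lia) }
  have q_eq (n : ℕ) : D.q n = 2 ^ Nat.clog 2 (digits n) := by
    change 2 ^ ((towerParams L κ n).1 + _ - (towerParams L κ n).1) = _
    rw [Nat.add_sub_cancel_left]
  have towerHeight_eq (n : ℕ) : D.towerHeight n = height n := by
    induction n with
    | zero => exact D.towerHeight_zero
    | succ n ih =>
      rw [D.towerHeight_succ, ih, spacerCount, q_eq]
      rfl
  refine ⟨D, rfl, fun n i => ?_, fun n => ?_, fun n => ?_⟩ <;> rw [towerHeight_eq]
  · rw [q_eq]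
    exact Nat.le_pow_clog one_lt_two _
  · rw [q_eq]
    exact two_pow_clog_le_two_mul (two_le_digits n)

/-- The times `⌊n ^ α⌋` at which the system is observed. -/
def powTimes (α : ℝ) (n : ℕ) : ℕ := ⌊(n : ℝ) ^ α⌋₊

theorem powTimes_zero {α : ℝ} (hα : α ≠ 0) : powTimes α 0 = 0 := by
  rw [powTimes, Nat.cast_zero, Real.zero_rpow hα, Nat.floor_zero]

theorem monotone_powTimes {α : ℝ} (hα : 0 ≤ α) : Monotone (powTimes α) := fun _ _ hab =>
  Nat.floor_mono (Real.rpow_le_rpow (Nat.cast_nonneg _) (Nat.cast_le.2 hab) hα)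

theorem powTimes_le (α : ℝ) (n : ℕ) : (powTimes α n : ℝ) ≤ n ^ α := Nat.floor_le (by positivity)

theorem add_one_rpow_le {α x : ℝ} (hα : 1 ≤ α) (hx : 0 ≤ x) :
    (x + 1) ^ α ≤ x ^ α + α * (x + 1) ^ (α - 1) := by
  have hx1 : 0 < x + 1 := by positivity
  have bernoulli := one_add_mul_self_le_rpow_one_add (s := -1 / (x + 1)) (p := α)
    (by rw [le_div_iff₀ hx1]; linarith) hα
  have base_eq : 1 + -1 / (x + 1) = x / (x + 1) := by
    field_simp
    ring
  rw [base_eq, Real.div_rpow hx hx1.le, le_div_iff₀ (by positivity)] at bernoulli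
  rw [Real.rpow_sub_one hx1.ne']
  calc (x + 1) ^ α
      = (1 + α * (-1 / (x + 1))) * (x + 1) ^ α + α * ((x + 1) ^ α / (x + 1)) := by ring
    _ ≤ x ^ α + α * ((x + 1) ^ α / (x + 1)) := by gcongr

theorem powTimes_succ_le_add {α : ℝ} (hα : 1 ≤ α) {k m : ℕ}
    (h : α * ((k : ℝ) + 1) ^ (α - 1) + 1 ≤ m) : powTimes α (k + 1) ≤ powTimes α k + m := by
  have increment_le := add_one_rpow_le hα (Nat.cast_nonneg (α := ℝ) k)
  have lt_floor_add_one : (k : ℝ) ^ α < powTimes α k + 1 := Nat.lt_floor_add_one _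
  refine Nat.floor_le_of_le ?_
  push_cast
  linarith

theorem eventually_add_mul_log_le {β : ℝ} (hβ : 0 < β) (a b : ℝ) {η : ℝ} (hη : 0 < η) :
    ∀ᶠ h : ℝ in atTop, a + b * Real.log h ≤ η * h ^ β := by
  have log_div : Tendsto (fun h : ℝ => Real.log h / h ^ β) atTop (nhds 0) :=
    (isLittleO_log_rpow_atTop hβ).tendsto_div_nhds_zero
  have const_div : Tendsto (fun h : ℝ => a / h ^ β) atTop (nhds 0) :=
    tendsto_const_nhds.div_atTop (tendsto_rpow_atTop hβ)
  have sum_lt := (const_div.add (log_div.const_mul b)).eventually_lt_const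
    (by rwa [mul_zero, add_zero])
  filter_upwards [sum_lt, eventually_gt_atTop 0] with h sum_lt h_pos
  rw [mul_div_assoc', ← add_div, div_lt_iff₀ (Real.rpow_pos_of_pos h_pos β)] at sum_lt
  exact sum_lt.le

theorem log_add_le {h c : ℝ} (hh : 1 ≤ h) (hc : 0 ≤ c) :
    Real.log (h + c) ≤ Real.log (1 + c) + Real.log h := by
  rw [← Real.log_mul (by positivity) (by positivity)]
  exact Real.log_le_log (by positivity) (by nlinarith)

theorem eventually_exists_lt_le_succ {f : ℕ → ℝ} (hf : Tendsto f atTop atTop) (n₀ : ℕ) :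
    ∀ᶠ x in atTop, ∃ n ≥ n₀, f n < x ∧ x ≤ f (n + 1) := by
  classical
  filter_upwards [eventually_gt_atTop (f n₀)] with x lt_x
  have exists_le : ∃ m, x ≤ f (n₀ + m + 1) :=
    (((tendsto_add_atTop_iff_nat 1).2 hf).comp
      (tendsto_add_atTop_nat n₀) |>.eventually_ge_atTop x).exists.imp
        fun m hm => by rwa [Function.comp_apply, Nat.add_comm m n₀] at hm
  refine ⟨n₀ + Nat.find exists_le, Nat.le_add_right _ _, ?_, Nat.find_spec exists_le⟩
  rcases Nat.eq_zero_or_eq_succ_pred (Nat.find exists_le) with find_eq | find_eq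
  · rwa [find_eq]
  · rw [find_eq]
    exact not_le.1 (Nat.find_min exists_le (by lia))

theorem rpow_inv_div_le {β c N H : ℝ} (hβ : 0 < β) (hc : 0 ≤ c) (hN : 0 ≤ N) (hH : 0 < H)
    (h : N ≤ (c * H) ^ β) : N ^ β⁻¹ / H ≤ c :=
  (div_le_iff₀ hH).2 ((Real.rpow_inv_le_iff_of_pos hN (by positivity) hβ).2 h)

theorem add_add_le_div_add_mul {h : ℕ} (hh : 0 < h) (l m : ℕ) :
    h + l + m ≤ (m / h + 2 + l) * h := by
  have m_lt := Nat.lt_div_mul_add hh (a := m)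
  have l_le := Nat.le_mul_of_pos_right l hh
  lia

theorem powTimes_one_add_inv_le {β : ℝ} (hβ : 0 < β) (N : ℕ) :
    (powTimes (1 + β⁻¹) N : ℝ) ≤ N * (N : ℝ) ^ β⁻¹ :=
  (powTimes_le _ N).trans_eq (Real.rpow_one_add' (Nat.cast_nonneg N) (by positivity))

theorem cast_powTimes_div_le {β : ℝ} (hβ : 0 < β) (N h : ℕ) :
    ((powTimes (1 + β⁻¹) N / h : ℕ) : ℝ) ≤ N * ((N : ℝ) ^ β⁻¹ / h) := by
  rw [← mul_div_assoc]
  exact Nat.cast_div_le.trans (by gcongr; exact powTimes_one_add_inv_le hβ N)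

/-- The two terms dominate each other in turn: for `N ≤ (δ H) ^ β` the second one is negligible,
afterwards the first one. -/
theorem add_mul_rpow_inv_div_mul_le {β C δ ε N H a ℓ : ℝ} (hβ : 0 < β) (hC : 0 ≤ C) (hδ : 0 ≤ δ)
    (hε : 0 ≤ ε) (hN : 0 ≤ N) (hH : 0 < H) (hℓ : 0 ≤ ℓ) (hδℓ : δ * ℓ ≤ ε)
    (ha : a ≤ N * (C * ℓ + ε)) (haH : a ≤ ε * (δ * H) ^ β) (hNH : N ≤ (C * H) ^ β) :
    a + N * (N ^ β⁻¹ / H) * ℓ ≤ N * (C * ℓ + 2 * ε) := by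
  rcases le_total N ((δ * H) ^ β) with hle | hge
  · have ratio_le := rpow_inv_div_le hβ hδ hN hH hle
    calc a + N * (N ^ β⁻¹ / H) * ℓ ≤ N * (C * ℓ + ε) + N * (δ * ℓ) := by
          rw [mul_assoc]
          gcongr
      _ ≤ N * (C * ℓ + ε) + N * ε := by gcongr
      _ = N * (C * ℓ + 2 * ε) := by ring
  · have ratio_le := rpow_inv_div_le hβ hC hN hH hNH
    calc a + N * (N ^ β⁻¹ / H) * ℓ ≤ ε * N + N * C * ℓ := by
          gcongr
          exact haH.trans (by gcongr)
      _ ≤ N * (C * ℓ + 2 * ε) := by linarith [mul_nonneg hN hε]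

/-- The length of the words to be placed at a tower of height `h`. The first `N = (C * h) ^ β` times
`⌊n ^ (1 + β⁻¹)⌋` just cover this many turns of the tower, so that the entropy per time is
`C * log L`. -/
def wordLength (β C : ℝ) (h : ℕ) : ℕ := ⌈C * (C * h) ^ β⌉₊

section WordLength

variable {β C : ℝ}

theorem wordLength_pos (β : ℝ) (hC : 0 < C) {h : ℕ} (hh : 0 < h) : 0 < wordLength β C h := by
  have : (0 : ℝ) < h := by exact_mod_cast hh
  exact Nat.ceil_pos.2 (by positivity)

theorem wordLength_le_add_one (β : ℝ) (hC : 0 ≤ C) (h : ℕ) :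
    wordLength β C h ≤ C * (C * h) ^ β + 1 :=
  (Nat.ceil_lt_add_one (by positivity)).le

theorem log_wordLength_le (hβ : 0 ≤ β) (hC : 0 < C) {h : ℕ} (hh : 0 < h) :
    Real.log (wordLength β C h) ≤ Real.log (C * C ^ β + 1) + β * Real.log h := by
  have one_le : (1 : ℝ) ≤ h := by exact_mod_cast hh
  have one_le_rpow : 1 ≤ (h : ℝ) ^ β := Real.one_le_rpow one_le hβ
  have length_pos : (0 : ℝ) < wordLength β C h := by exact_mod_cast wordLength_pos β hC hh
  rw [← Real.log_rpow (by linarith), ← Real.log_mul (by positivity) (by positivity)]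
  refine Real.log_le_log length_pos ((wordLength_le_add_one β hC.le h).trans ?_)
  rw [Real.mul_rpow hC.le (Nat.cast_nonneg h)]
  linarith

end WordLength

namespace SpacerScheme

variable {D : SpacerScheme}

theorem le_towerHeight (D : SpacerScheme) (n : ℕ) : n ≤ D.towerHeight n :=
  D.strictMono_E.le_apply.trans (Nat.lt_two_pow_self.le.trans (D.two_pow_le_towerHeight n))

theorem tendsto_towerHeight (D : SpacerScheme) :
    Tendsto (fun n => (D.towerHeight n : ℝ)) atTop atTop :=
  tendsto_natCast_atTop_atTop.comp (tendsto_atTop_mono D.le_towerHeight tendsto_id)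

theorem HasWordLengths.towerHeight_succ_add_le {κ : ℕ → ℕ} (hD : D.HasWordLengths κ) {n : ℕ}
    (hκ : 0 < κ (D.towerHeight n)) :
    D.towerHeight (n + 1) + D.L ≤
      4 * (κ (D.towerHeight n) * D.L ^ κ (D.towerHeight n)) * (D.towerHeight n + D.L) := by
  have digits_pos : 0 < κ (D.towerHeight n) * D.L ^ κ (D.towerHeight n) :=
    Nat.mul_pos hκ (Nat.pow_pos D.L_pos)
  have spacers_le := D.spacerCount_le n
  have q_le := Nat.mul_le_mul_right (D.towerHeight n + D.L) (hD.q_le n)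
  have L_le := Nat.mul_le_mul digits_pos (Nat.le_add_left D.L (D.towerHeight n))
  rw [D.towerHeight_succ]
  lia

theorem eventually_add_log_towerHeight_add_le (D : SpacerScheme) {β δ ε : ℝ} (hβ : 0 < β)
    (hδ : 0 < δ) (hε : 0 < ε) (c : ℝ) :
    ∀ᶠ n in atTop, c + Real.log (D.towerHeight n + D.L) ≤ ε * (δ * D.towerHeight n) ^ β := by
  filter_upwards [D.tendsto_towerHeight.eventually
    (eventually_add_mul_log_le hβ (c + Real.log (1 + D.L)) 1 (η := ε * δ ^ β) (by positivity))]
    with n log_le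
  rw [mul_assoc, ← Real.mul_rpow hδ.le (Nat.cast_nonneg _)] at log_le
  have one_le : (1 : ℝ) ≤ D.towerHeight n := by exact_mod_cast D.towerHeight_pos n
  linarith [log_add_le one_le (Nat.cast_nonneg D.L)]

section WordLength

variable {β C : ℝ} (hβ : 0 < β) (hC : 0 < C) (hD : D.HasWordLengths (wordLength β C))
include hβ hC hD

theorem HasWordLengths.exists_log_towerHeight_succ_add_le :
    ∃ c : ℝ, ∀ n, Real.log (D.towerHeight (n + 1) + D.L) ≤
      C * (C * D.towerHeight n) ^ β * Real.log D.L +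
        (c + (β + 1) * Real.log (D.towerHeight n)) := by
  refine ⟨Real.log 4 + Real.log (C * C ^ β + 1) + Real.log D.L + Real.log (1 + D.L), fun n => ?_⟩
  have L_pos : (0 : ℝ) < D.L := by exact_mod_cast D.L_pos
  have one_le : (1 : ℝ) ≤ D.towerHeight n := by exact_mod_cast D.towerHeight_pos n
  have κ_pos := wordLength_pos β hC (D.towerHeight_pos n)
  have κ_pos' : (0 : ℝ) < wordLength β C (D.towerHeight n) := by exact_mod_cast κ_pos
  have log_κ_le := log_wordLength_le hβ.le hC (D.towerHeight_pos n)
  have log_height_le := log_add_le one_le L_pos.le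
  have κ_mul_le := mul_le_mul_of_nonneg_right (wordLength_le_add_one β hC.le (D.towerHeight n))
    (Real.log_natCast_nonneg D.L)
  calc Real.log (D.towerHeight (n + 1) + D.L)
      ≤ Real.log (4 * (wordLength β C (D.towerHeight n) *
          D.L ^ wordLength β C (D.towerHeight n)) * (D.towerHeight n + D.L)) :=
        Real.log_le_log (by positivity) (by exact_mod_cast hD.towerHeight_succ_add_le κ_pos)
    _ = Real.log 4 + (Real.log (wordLength β C (D.towerHeight n)) +
          wordLength β C (D.towerHeight n) * Real.log D.L) +
          Real.log (D.towerHeight n + D.L) := by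
        rw [Real.log_mul (by positivity) (by positivity),
          Real.log_mul (by positivity) (by positivity),
          Real.log_mul κ_pos'.ne' (by positivity), Real.log_pow]
    _ ≤ _ := by linarith

theorem HasWordLengths.eventually_log_towerHeight_succ_add_le {ε : ℝ} (hε : 0 < ε) :
    ∀ᶠ n in atTop, Real.log (D.towerHeight (n + 1) + D.L) ≤
      (C * D.towerHeight n) ^ β * (C * Real.log D.L + ε) := by
  obtain ⟨c, log_le⟩ := hD.exists_log_towerHeight_succ_add_le hβ hC
  filter_upwards [D.tendsto_towerHeight.eventually
    (eventually_add_mul_log_le hβ c (β + 1) (η := ε * C ^ β) (by positivity))] with n rest_le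
  rw [mul_assoc, ← Real.mul_rpow hC.le (Nat.cast_nonneg _)] at rest_le
  linarith [log_le n]

theorem HasWordLengths.eventually_exists_tower (r : ℕ) {ε : ℝ} (hε : 0 < ε) :
    ∀ᶠ N : ℕ in atTop, ∃ n ≥ r, ∃ W : ℕ,
      D.towerHeight n + D.L + powTimes (1 + β⁻¹) N ≤ W * D.towerHeight n ∧
      Real.log (D.towerHeight n + D.L) + W * Real.log D.L ≤ N * (C * Real.log D.L + 3 * ε) := by
  have log_L_nonneg : 0 ≤ Real.log D.L := Real.log_natCast_nonneg D.L
  obtain ⟨δ, δ_pos, δ_mul_le⟩ : ∃ δ > 0, δ * Real.log D.L ≤ ε :=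
    ⟨ε / (Real.log D.L + 1), by positivity,
      by rw [div_mul_eq_mul_div, div_le_iff₀ (by positivity)]; linarith⟩
  obtain ⟨n₀, log_le⟩ := eventually_atTop.1
    ((hD.eventually_log_towerHeight_succ_add_le hβ hC hε).and
      (D.eventually_add_log_towerHeight_add_le hβ δ_pos hε 0))
  have tendsto_range : Tendsto (fun n => (C * D.towerHeight n) ^ β) atTop atTop :=
    (tendsto_rpow_atTop hβ).comp (D.tendsto_towerHeight.const_mul_atTop hC)
  filter_upwards [tendsto_natCast_atTop_atTop.eventually
      (eventually_exists_lt_le_succ tendsto_range (max n₀ r)),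
    tendsto_natCast_atTop_atTop.eventually_ge_atTop ((2 + D.L) * Real.log D.L / ε)]
    with N ⟨n, hn, lt_N, N_le⟩ le_N
  let H := D.towerHeight (n + 1)
  have H_pos : 0 < H := D.towerHeight_pos _
  refine ⟨n + 1, by lia, powTimes (1 + β⁻¹) N / H + 2 + D.L,
    add_add_le_div_add_mul H_pos _ _, ?_⟩
  have log_height_le : Real.log (H + D.L) ≤ N * (C * Real.log D.L + ε) :=
    (log_le n (by lia)).1.trans (by gcongr)
  have main_le := add_mul_rpow_inv_div_mul_le hβ hC.le δ_pos.le hε.le (Nat.cast_nonneg N)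
    (Nat.cast_pos.2 H_pos) log_L_nonneg δ_mul_le log_height_le
    (by simpa only [zero_add] using (log_le (n + 1) (by lia)).2) N_le
  have turns_le : (powTimes (1 + β⁻¹) N / H : ℕ) * Real.log D.L ≤
      N * ((N : ℝ) ^ β⁻¹ / H) * Real.log D.L := by
    gcongr
    exact cast_powTimes_div_le hβ N H
  rw [div_le_iff₀ hε] at le_N
  push_cast
  linarith

theorem HasWordLengths.seqEntropy_le :
    seqEntropy D.μ D.T (powTimes (1 + β⁻¹)) ≤ ((C * Real.log D.L : ℝ) : EReal) := by
  refine iSup_le fun m => iSup_le fun φ => iSup_le fun hφ =>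
    EReal.le_of_forall_lt_iff_le.1 fun y hy => ?_
  rw [EReal.coe_lt_coe_iff] at hy
  let ε := (y - C * Real.log D.L) / 4
  have ε_pos : 0 < ε := by
    have : 0 < y - C * Real.log D.L := sub_pos.2 hy
    positivity
  obtain ⟨r, g, entropy_le⟩ := D.exists_shannonEntropy_seqCoding_le hφ (powTimes (1 + β⁻¹)) ε_pos
  refine limsup_le_of_le (by isBoundedDefault) ?_
  filter_upwards [hD.eventually_exists_tower hβ hC r ε_pos, eventually_gt_atTop 0]
    with N ⟨n, hn, W, hW, log_le⟩ N_pos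
  have offset_le := D.shannonEntropy_seqCoding_offset_le g hn
    (monotone_powTimes (α := 1 + β⁻¹) (by positivity)) hW
  rw [EReal.coe_le_coe_iff, one_div, inv_mul_le_iff₀ (Nat.cast_pos.2 N_pos)]
  calc shannonEntropy D.μ (seqCoding D.T (powTimes (1 + β⁻¹)) φ N)
      ≤ N * (C * Real.log D.L + 3 * ε) + N * ε :=
        (entropy_le N).trans (by gcongr; exact offset_le.trans log_le)
    _ = N * y := by
        simp only [ε]
        ring

end WordLength

end SpacerScheme

theorem eventually_mul_add_le_mul {a b : ℝ} (hab : a < b) (c : ℝ) :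
    ∀ᶠ x : ℝ in atTop, a * x + c ≤ b * x := by
  filter_upwards [eventually_ge_atTop (c / (b - a))] with x hx
  rw [div_le_iff₀ (sub_pos.2 hab)] at hx
  linarith

theorem eventually_mul_rpow_le_floor {β w v : ℝ} (hβ : 0 < β) (hw : 0 ≤ w) (hwv : w < v) :
    ∀ᶠ x : ℝ in atTop, (w * x) ^ β ≤ ⌊(v * x) ^ β⌋₊ := by
  filter_upwards [(tendsto_rpow_atTop hβ).eventually
    (eventually_mul_add_le_mul (Real.rpow_lt_rpow hw hwv hβ) 1), eventually_ge_atTop 0]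
    with x hx x_nonneg
  rw [← Real.mul_rpow hw x_nonneg, ← Real.mul_rpow (hw.trans hwv.le) x_nonneg] at hx
  exact (le_sub_iff_add_le.2 hx).trans (Nat.sub_one_lt_floor _).le

theorem powTimes_succ_le_add_of_lt_floor {β v : ℝ} (hβ : 0 < β) (hv : 0 ≤ v) {h k : ℕ}
    (hh : (1 + β⁻¹) * (v * h) + 1 ≤ h) (hk : k < ⌊(v * h) ^ β⌋₊) :
    powTimes (1 + β⁻¹) (k + 1) ≤ powTimes (1 + β⁻¹) k + h := by
  have succ_le : (k + 1 : ℝ) ≤ (v * h) ^ β := by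
    exact_mod_cast (Nat.le_floor_iff (by positivity)).1 (Nat.succ_le_of_lt hk)
  have root_le := (Real.rpow_inv_le_iff_of_pos (by positivity) (by positivity) hβ).2 succ_le
  refine powTimes_succ_le_add (le_add_of_nonneg_right (by positivity)) (le_trans ?_ hh)
  rw [add_sub_cancel_left]
  gcongr

theorem powTimes_floor_div_le_wordLength {β v C : ℝ} (hβ : 0 < β) (hv : 0 ≤ v) (hvC : v ≤ C)
    {h : ℕ} (hh : 0 < h) (l : ℕ) :
    powTimes (1 + β⁻¹) ⌊(v * h) ^ β⌋₊ / (h + l) ≤ wordLength β C h := by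
  have h_pos : (0 : ℝ) < h := Nat.cast_pos.2 hh
  have C_nonneg := hv.trans hvC
  have N_le : (⌊(v * h) ^ β⌋₊ : ℝ) ≤ (v * h) ^ β := Nat.floor_le (by positivity)
  have ratio_le := rpow_inv_div_le hβ hv (Nat.cast_nonneg _) h_pos N_le
  refine (Nat.div_le_div_left (Nat.le_add_right h l) hh).trans ((Nat.cast_le (α := ℝ)).1 ?_)
  calc ((powTimes (1 + β⁻¹) ⌊(v * h) ^ β⌋₊ / h : ℕ) : ℝ)
      ≤ ⌊(v * h) ^ β⌋₊ * ((⌊(v * h) ^ β⌋₊ : ℝ) ^ β⁻¹ / h) := cast_powTimes_div_le hβ _ h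
    _ ≤ (v * h) ^ β * v := by gcongr
    _ ≤ (C * h) ^ β * C := by gcongr
    _ ≤ wordLength β C h := by
        rw [mul_comm]
        exact Nat.le_ceil _

theorem mul_sub_two_le_powTimes_div {β w : ℝ} (hβ : 0 < β) {N h : ℕ} (hh : 0 < h)
    (hw : w * h ≤ (N : ℝ) ^ β⁻¹) : w * N - 2 ≤ (powTimes (1 + β⁻¹) N / h : ℕ) := by
  have one_le : (1 : ℝ) ≤ h := by exact_mod_cast hh
  have lt_turns : (powTimes (1 + β⁻¹) N : ℝ) < (powTimes (1 + β⁻¹) N / h : ℕ) * h + h := by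
    exact_mod_cast Nat.lt_div_mul_add hh
  have lt_powTimes : (N : ℝ) * (N : ℝ) ^ β⁻¹ < powTimes (1 + β⁻¹) N + 1 := by
    rw [← Real.rpow_one_add' (Nat.cast_nonneg N) (by positivity)]
    exact Nat.lt_floor_add_one _
  have mul_le : (N : ℝ) * (w * h) ≤ N * (N : ℝ) ^ β⁻¹ := by gcongr
  refine le_of_mul_le_mul_right ?_ (Nat.cast_pos.2 hh : (0 : ℝ) < h)
  linarith

theorem exists_pos_lt_lt_mul {C y ℓ : ℝ} (hC : 0 < C) (hy : y < C * ℓ) :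
    ∃ w, 0 < w ∧ w < C ∧ y < w * ℓ := by
  have tendsto_mul : Tendsto (fun w => w * ℓ) (nhdsWithin C (Set.Iio C)) (nhds (C * ℓ)) :=
    (continuous_mul_const ℓ).continuousWithinAt
  obtain ⟨w, y_lt, w_pos, w_lt⟩ := ((tendsto_mul.eventually_const_lt hy).and
    (Ioo_mem_nhdsLT hC)).exists
  exact ⟨w, w_pos, w_lt, y_lt⟩

namespace SpacerScheme

variable {D : SpacerScheme} {β C : ℝ}

theorem HasWordLengths.le_shannonEntropy_powTimes (hβ : 0 < β) (hC : 0 < C)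
    (hD : D.HasWordLengths (wordLength β C)) {v w ε : ℝ} (hv : 0 ≤ v) (hvC : v ≤ C) {r n N : ℕ}
    (hrn : r ≤ n) (hN : N = ⌊(v * D.towerHeight n) ^ β⌋₊)
    (hw : w * (D.towerHeight n + D.L) ≤ (N : ℝ) ^ β⁻¹)
    (hstep : (1 + β⁻¹) * (v * D.towerHeight n) + 1 ≤ D.towerHeight n)
    (hε : ∀ k, shannonEntropy D.μ (D.edgeGap r n (powTimes (1 + β⁻¹)) k) ≤ ε) :
    (w * N - 2) * Real.log D.L - Real.log (3 * D.L) - Real.log (D.towerHeight n + D.L) - N * ε ≤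
      shannonEntropy D.μ (seqCoding D.T (powTimes (1 + β⁻¹)) (D.offsetFin r) N) := by
  subst hN
  have height_pos := D.towerHeight_pos n
  have le_turns := mul_sub_two_le_powTimes_div hβ (Nat.add_pos_left height_pos D.L)
    (by exact_mod_cast hw)
  have le_entropy := le_shannonEntropy_seqCoding_offsetFin hrn (powTimes_zero (by positivity))
    (monotone_powTimes (by positivity))
    (fun k hk => powTimes_succ_le_add_of_lt_floor hβ hv hstep hk)
    (Nat.div_mul_le_self _ _) hε (wordLength_pos β hC height_pos)
    (powTimes_floor_div_le_wordLength hβ hv hvC height_pos D.L) (hD.a_eq n) (hD.le_q n)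
  linarith [mul_le_mul_of_nonneg_right le_turns (Real.log_natCast_nonneg D.L)]

theorem HasWordLengths.exists_tendsto_le_shannonEntropy (hβ : 0 < β) (hC : 0 < C)
    (hD : D.HasWordLengths (wordLength β C)) (hβC : (1 + β⁻¹) * C ≤ 1) {y : ℝ}
    (hy : y < C * Real.log D.L) :
    ∃ r, ∃ N : ℕ → ℕ, Tendsto N atTop atTop ∧ ∀ᶠ n in atTop,
      N n * y ≤
        shannonEntropy D.μ (seqCoding D.T (powTimes (1 + β⁻¹)) (D.offsetFin r) (N n)) := by
  obtain ⟨w, w_pos, w_lt, y_lt⟩ := exists_pos_lt_lt_mul hC hy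
  obtain ⟨u, w_lt_u, u_lt⟩ := exists_between w_lt
  obtain ⟨v, u_lt_v, v_lt⟩ := exists_between u_lt
  have u_pos : 0 < u := w_pos.trans w_lt_u
  have v_pos : 0 < v := u_pos.trans u_lt_v
  have step_coeff_lt : (1 + β⁻¹) * v < 1 :=
    (mul_lt_mul_of_pos_left v_lt (by positivity)).trans_le hβC
  let ε := (w * Real.log D.L - y) / 2
  have ε_pos : 0 < ε := half_pos (sub_pos.2 y_lt)
  obtain ⟨r, edgeGap_lt⟩ := D.exists_forall_shannonEntropy_edgeGap_lt ε_pos (powTimes (1 + β⁻¹))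
  refine ⟨r, fun n => ⌊(v * D.towerHeight n) ^ β⌋₊, tendsto_nat_floor_atTop.comp
    ((tendsto_rpow_atTop hβ).comp (D.tendsto_towerHeight.const_mul_atTop v_pos)), ?_⟩
  filter_upwards [eventually_ge_atTop r,
    D.tendsto_towerHeight.eventually (eventually_mul_rpow_le_floor hβ u_pos.le u_lt_v),
    D.tendsto_towerHeight.eventually (eventually_mul_add_le_mul w_lt_u (w * D.L)),
    D.tendsto_towerHeight.eventually (eventually_mul_add_le_mul step_coeff_lt 1),
    D.eventually_add_log_towerHeight_add_le hβ u_pos ε_pos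
      (2 * Real.log D.L + Real.log (3 * D.L))] with n hrn le_N w_mul_le step_le logs_le
  have le_root : w * (D.towerHeight n + D.L) ≤ (⌊(v * D.towerHeight n) ^ β⌋₊ : ℝ) ^ β⁻¹ :=
    calc w * (D.towerHeight n + D.L) ≤ u * D.towerHeight n := by linarith
      _ ≤ _ := (Real.le_rpow_inv_iff_of_pos (by positivity) (by positivity) hβ).2 le_N
  have le_entropy := hD.le_shannonEntropy_powTimes hβ hC v_pos.le v_lt.le hrn rfl le_root
    (by linarith) fun k => (edgeGap_lt n k).le
  have y_eq : y = w * Real.log D.L - 2 * ε := by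
    simp only [ε]
    ring
  rw [y_eq]
  linarith [mul_le_mul_of_nonneg_left le_N ε_pos.le]

theorem HasWordLengths.le_seqEntropy (hβ : 0 < β) (hC : 0 < C)
    (hD : D.HasWordLengths (wordLength β C)) (hβC : (1 + β⁻¹) * C ≤ 1) :
    ((C * Real.log D.L : ℝ) : EReal) ≤ seqEntropy D.μ D.T (powTimes (1 + β⁻¹)) := by
  refine EReal.ge_of_forall_gt_iff_ge.1 fun y hy => ?_
  rw [EReal.coe_lt_coe_iff] at hy
  obtain ⟨r, N, tendsto_N, le_entropy⟩ := hD.exists_tendsto_le_shannonEntropy hβ hC hβC hy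
  refine le_iSup_of_le _ (le_iSup_of_le (D.offsetFin r)
    (le_iSup_of_le (D.measurable_offsetFin r) ?_))
  refine le_limsup_of_frequently_le (tendsto_N.frequently (Eventually.frequently ?_))
    (by isBoundedDefault)
  filter_upwards [le_entropy, tendsto_N.eventually_gt_atTop 0] with n le_entropy N_pos
  rw [EReal.coe_le_coe_iff, one_div, le_inv_mul_iff₀ (Nat.cast_pos.2 N_pos)]
  exact le_entropy

end SpacerScheme

theorem exists_isRankOneSystem_seqEntropy_eq {L : ℕ} (hL : 2 ≤ L) {β C : ℝ} (hβ : 0 < β)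
    (hC : 0 < C) (hβC : (1 + β⁻¹) * C ≤ 1) :
    ∃ (X : Type) (_ : MeasurableSpace X) (μ : Measure X) (T : X ≃ᵐ X), IsRankOneSystem μ T ∧
      seqEntropy μ T (powTimes (1 + β⁻¹)) = ((C * Real.log L : ℝ) : EReal) := by
  obtain ⟨D, rfl, hD⟩ := exists_hasWordLengths hL fun _ => wordLength_pos β hC
  exact ⟨D.Space, inferInstance, D.μ, D.T, D.isRankOneSystem,
    le_antisymm (hD.seqEntropy_le hβ hC) (hD.le_seqEntropy hβ hC hβC)⟩

theorem div_one_add_le_rpow {β : ℝ} (hβ : 0 < β) :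
    β / (1 + β) ≤ (2 * β) ^ (1 / (1 + β)) := by
  have le_one : β / (1 + β) ≤ 1 := (div_le_one (by positivity)).2 (by linarith)
  have le_self : β / (1 + β) ≤ β := div_le_self hβ.le (by linarith)
  have exponent_le_one : 1 / (1 + β) ≤ 1 := (div_le_one (by positivity)).2 (by linarith)
  rcases le_total 1 (2 * β) with one_le | le_one'
  · exact le_one.trans (Real.one_le_rpow one_le (by positivity))
  · calc β / (1 + β) ≤ 2 * β := by linarith
      _ = (2 * β) ^ (1 : ℝ) := (Real.rpow_one _).symm
      _ ≤ (2 * β) ^ (1 / (1 + β)) :=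
        Real.rpow_le_rpow_of_exponent_ge (by positivity) le_one' exponent_le_one

end SeqEnt

end

theorem mainTheorem5 (β : ℝ) (hβ : 0 < β) (α : ℝ) (hα : α = 1 + 1 / β)
    (t : ℕ → ℕ) (ht : ∀ n : ℕ, t n = ⌊(n : ℝ) ^ α⌋₊) :
    (∀ m : ℝ, 0 < m →
      ∃ (X : Type) (_ : MeasurableSpace X) (μ : Measure X) (T : X ≃ᵐ X),
        SeqEnt.IsRankOneSystem μ T ∧
        0 < SeqEnt.seqEntropy μ T t ∧ SeqEnt.seqEntropy μ T t < (m : EReal)) ∧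
    (∀ L : ℕ, 2 ≤ L →
      ∃ (X : Type) (_ : MeasurableSpace X) (μ : Measure X) (T : X ≃ᵐ X),
        SeqEnt.IsRankOneSystem μ T ∧
        ((β / (1 + β) * Real.log L : ℝ) : EReal) ≤ SeqEnt.seqEntropy μ T t ∧
        SeqEnt.seqEntropy μ T t ≤ (((2 * β) ^ (1 / (1 + β)) * Real.log L : ℝ) : EReal)) := by
  obtain rfl : t = SeqEnt.powTimes (1 + β⁻¹) :=
    funext fun n => by rw [ht, hα, one_div, SeqEnt.powTimes]
  have exponent_mul_le {C : ℝ} (hC : C ≤ β / (1 + β)) : (1 + β⁻¹) * C ≤ 1 :=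
    calc (1 + β⁻¹) * C ≤ (1 + β⁻¹) * (β / (1 + β)) := by gcongr
      _ = 1 := by field_simp; ring
  refine ⟨fun m hm => ?_, fun L hL => ?_⟩
  · have log_pos : 0 < Real.log (2 : ℕ) := Real.log_pos (by norm_num)
    obtain ⟨C, C_pos, C_lt⟩ : ∃ C, 0 < C ∧ C < min (β / (1 + β)) (m / Real.log (2 : ℕ)) :=
      exists_between (by positivity)
    obtain ⟨C_lt_ratio, C_lt_div⟩ := lt_min_iff.1 C_lt
    obtain ⟨X, mX, μ, T, isRankOne, entropy_eq⟩ :=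
      SeqEnt.exists_isRankOneSystem_seqEntropy_eq le_rfl hβ C_pos (exponent_mul_le C_lt_ratio.le)
    refine ⟨X, mX, μ, T, isRankOne, ?_, ?_⟩ <;> rw [entropy_eq]
    · exact_mod_cast mul_pos C_pos log_pos
    · exact_mod_cast (lt_div_iff₀ log_pos).1 C_lt_div
  · obtain ⟨X, mX, μ, T, isRankOne, entropy_eq⟩ :=
      SeqEnt.exists_isRankOneSystem_seqEntropy_eq hL hβ (by positivity) (exponent_mul_le le_rfl)
    refine ⟨X, mX, μ, T, isRankOne, entropy_eq.ge, ?_⟩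
    rw [entropy_eq, EReal.coe_le_coe_iff]
    exact mul_le_mul_of_nonneg_right (SeqEnt.div_one_add_le_rpow hβ) (Real.log_natCast_nonneg L)
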